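/- **Vocabulary and language.** Let $V$ be a finite set of basic variables, $\mathit{Pred}$ a set of predicate symbols and $ar:\mathit{Pred}\to\mathbb N$ an arity function, where $\mathit{Pred}$ is finite or effectively enumerated and $ar$ is computable. Terms and formulas are given by $$x ::= v \mid \bigcirc x,\qquad \varphi ::= P(x_1,\dots,x_k)\mid \neg\varphi\mid\varphi\wedge\varphi\mid\bigcirc\varphi\mid\mathsf D_X\varphi\mid D_Xx,$$ where $v\in V$, $P\in\mathit{Pred}$ has arity $k$, and $X$ is a finite set of terms. Let $\mathcal L^{\neq\emptyset}$ be the set of those formulas in which every operator $\mathsf D_X$ and every atom $D_Xx$ has $X\neq\emptyset$. **Semantics.** A *dynamical dependence model* $\mathbf M$ consists of a set $S$ of states, a map $g:S\to S$, for each $v\in V$ a set $\mathbb D_v$ and a map $\mathbf v:S\to\mathbb D_v$, and for each $P\in\mathit{Pred}$ an $ar(P)$-ary relation $I(P)$ on $\bigcup_{v\in V}\mathbb D_v$, such that states are determined by the values of the basic variables: if $\mathbf v(s)=\mathbf v(t)$ for all $v\in V$, then $s=t$. Terms are interpreted by $(\bigcirc\mathbf x)(s):=\mathbf x(g(s))$;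 write $s=_Xt$ if $\mathbf x(s)=\mathbf x(t)$ for all $x\in X$. Truth at a state $s$ is defined by the usual clauses for $\neg,\wedge$ and: - $s\models P(x_1,\dots,x_k)$ iff $(\mathbf x_1(s),\dots,\mathbf x_k(s))\in I(P)$; - $s\models\bigcirc\varphi$ iff $g(s)\models\varphi$; - $s\models\mathsf D_X\varphi$ iff $t\models\varphi$ for all $t\in S$ with $s=_Xt$; - $s\models D_Xy$ iff $\mathbf y(s)=\mathbf y(t)$ for all $t\in S$ with $s=_Xt$. The logic $\mathsf{DFD}^{\neq\emptyset}$ is the set of all formulas of $\mathcal L^{\neq\emptyset}$ that are true at every state of every dynamical dependence model. **Theorem.** The logic $\mathsf{DFD}^{\neq\emptyset}$ is decidable: there is an algorithm that decides, given (the Gödel number of) a formula, whether it belongs to $\mathsf{DFD}^{\neq\emptyset}$. -/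

import Mathlib

universe u v w

namespace DFD

/-- Terms `x ::= v | ○x` over a set `V` of basic variables. -/
inductive Term (V : Type*) where
  | var (v : V) : Term V
  | next (x : Term V) : Term V

/-- Formulas over the vocabulary `(V, Pred, ar)`:
`φ ::= P(x₁, …, x_k) | ¬φ | φ ∧ φ | ○φ | 𝖣_X φ | D_X y`,
with `X` a finite (possibly empty) set of terms. -/
inductive Formula (V : Type*) {Pred : Type*} (ar : Pred → ℕ) where
  | atom (P : Pred) (x : Fin (ar P) → Term V) : Formula V ar
  | neg (φ : Formula V ar) : Formula V ar
  | and (φ ψ : Formula V ar) : Formula V ar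
  | next (φ : Formula V ar) : Formula V ar
  | quant (X : Finset (Term V)) (φ : Formula V ar) : Formula V ar
  | dep (X : Finset (Term V)) (y : Term V) : Formula V ar

/-- The sublanguage `ℒ^{≠∅}`: no subformula has the form `𝖣_∅ φ` or `D_∅ y`. -/
def Formula.EmptyFree {V Pred : Type*} {ar : Pred → ℕ} : Formula V ar → Prop
  | .atom _ _ => True
  | .neg φ => φ.EmptyFree
  | .and φ ψ => φ.EmptyFree ∧ ψ.EmptyFree
  | .next φ => φ.EmptyFree
  | .quant X φ => X.Nonempty ∧ φ.EmptyFree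
  | .dep X _ => X.Nonempty

/-- Dynamical dependence models for the vocabulary `(V, Pred, ar)`. -/
structure DynModel (V : Type u) {Pred : Type v} (ar : Pred → ℕ) where
  /-- the set of states -/
  S : Type w
  /-- the dynamical map -/
  g : S → S
  /-- an ambient set containing all the value ranges -/
  U : Type w
  /-- the range of values of each basic variable; ranges may overlap -/
  D : V → Set U
  /-- the interpretation of each predicate symbol: a set of tuples of values -/
  I : (P : Pred) → Set (Fin (ar P) → U)
  /-- each `I P` is a relation on the union of the value ranges -/
  I_subset : ∀ P, ∀ a ∈ I P, ∀ i, a i ∈ ⋃ v, D v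
  /-- the dynamical variable denoted by each basic variable -/
  val : (v : V) → S → D v
  /-- states are uniquely determined by the values of all the basic variables -/
  state_ext : ∀ s t : S, (∀ v, val v s = val v t) → s = t

namespace DynModel

variable {V : Type u} {Pred : Type v} {ar : Pred → ℕ}

/-- The value `x(s)` of a term `x` at a state `s`, with `(○x)(s) = x(g(s))`. -/
def termVal (M : DynModel.{u, v, w} V ar) : Term V → M.S → M.U
  | .var v, s => M.val v s
  | .next x, s => M.termVal x (M.g s)

/-- `X`-value agreement `s =_X t`. -/
def Agree (M : DynModel.{u, v, w} V ar) (X : Finset (Term V)) (s t : M.S) : Prop :=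
  ∀ x ∈ X, M.termVal x s = M.termVal x t

/-- Truth of a formula at a state. -/
def Sat (M : DynModel.{u, v, w} V ar) : Formula V ar → M.S → Prop
  | .atom P x, s => (fun i => M.termVal (x i) s) ∈ M.I P
  | .neg φ, s => ¬ M.Sat φ s
  | .and φ ψ, s => M.Sat φ s ∧ M.Sat ψ s
  | .next φ, s => M.Sat φ (M.g s)
  | .quant X φ, s => ∀ t, M.Agree X s t → M.Sat φ t
  | .dep X y, s => ∀ t, M.Agree X s t → M.termVal y s = M.termVal y t

end DynModel

/-- Validity: truth at all states of all dynamical dependence models. -/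
def Formula.Valid {V : Type u} {Pred : Type v} {ar : Pred → ℕ} (φ : Formula V ar) : Prop :=
  ∀ (M : DynModel.{u, v, w} V ar) (s : M.S), M.Sat φ s

/-- Gödel numbers of terms. -/
def Term.code {V : Type*} [Encodable V] : Term V → ℕ
  | .var v => Nat.pair 0 (Encodable.encode v)
  | .next x => Nat.pair 1 x.code

/-- Gödel numbers of finite sets of terms: the `1`s in the binary expansion are at the positions
given by the Gödel numbers of the elements. -/
def setCode {V : Type*} [Encodable V] (X : Finset (Term V)) : ℕ :=
  ∑ x ∈ X, 2 ^ x.code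

/-- Gödel numbers of formulas. -/
def Formula.code {V Pred : Type*} [Encodable V] [Encodable Pred] {ar : Pred → ℕ} :
    Formula V ar → ℕ
  | .atom P x =>
      Nat.pair 0 (Nat.pair (Encodable.encode P)
        (Encodable.encode (List.ofFn fun i => (x i).code)))
  | .neg φ => Nat.pair 1 φ.code
  | .and φ ψ => Nat.pair 2 (Nat.pair φ.code ψ.code)
  | .next φ => Nat.pair 3 φ.code
  | .quant X φ => Nat.pair 4 (Nat.pair (setCode X) φ.code)
  | .dep X y => Nat.pair 5 (Nat.pair (setCode X) y.code)

theorem Term.code_injective {V : Type*} [Encodable V] :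
    Function.Injective (Term.code : Term V → ℕ) := by
  intro x
  induction x with
  | var v =>
    intro y h
    cases y with
    | var w => simpa [Term.code] using h
    | next y => simp [Term.code] at h
  | next x ih =>
    intro y h
    cases y with
    | var w => simp [Term.code] at h
    | next y =>
      simp only [Term.code, Nat.pair_eq_pair, true_and] at h
      rw [ih h]

theorem setCode_injective {V : Type*} [Encodable V] :
    Function.Injective (setCode : Finset (Term V) → ℕ) := by
  intro X Y h
  have key : ∀ Z : Finset (Term V),
      setCode Z = ∑ i ∈ Z.map ⟨Term.code, Term.code_injective⟩, 2 ^ i := by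
    intro Z
    simp [setCode]
  rw [key, key] at h
  exact Finset.map_injective _ (Finset.geomSum_injective le_rfl h)

/-- Distinct formulas have distinct Gödel numbers. -/
theorem Formula.code_injective {V Pred : Type*} [Encodable V] [Encodable Pred] {ar : Pred → ℕ} :
    Function.Injective (Formula.code : Formula V ar → ℕ) := by
  intro φ
  induction φ with
  | atom P x =>
    intro ψ h
    cases ψ <;> simp only [Formula.code, Nat.pair_eq_pair] at h <;> try omega
    rename_i Q y
    obtain ⟨-, h1, h2⟩ := h
    obtain rfl := Encodable.encode_injective h1
    have h3 := List.ofFn_injective (Encodable.encode_injective h2)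
    congr 1
    funext i
    exact Term.code_injective (congrFun h3 i)
  | neg φ ih =>
    intro ψ h
    cases ψ <;> simp only [Formula.code, Nat.pair_eq_pair] at h <;> try omega
    rw [ih h.2]
  | and φ₁ φ₂ ih₁ ih₂ =>
    intro ψ h
    cases ψ <;> simp only [Formula.code, Nat.pair_eq_pair] at h <;> try omega
    rw [ih₁ h.2.1, ih₂ h.2.2]
  | next φ ih =>
    intro ψ h
    cases ψ <;> simp only [Formula.code, Nat.pair_eq_pair] at h <;> try omega
    rw [ih h.2]
  | quant X φ ih =>
    intro ψ h
    cases ψ <;> simp only [Formula.code, Nat.pair_eq_pair] at h <;> try omega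
    rw [setCode_injective h.2.1, ih h.2.2]
  | dep X y =>
    intro ψ h
    cases ψ <;> simp only [Formula.code, Nat.pair_eq_pair] at h <;> try omega
    rw [setCode_injective h.2.1, Term.code_injective h.2.2]

end DFD

/-! A formula without empty dependence sets, evaluated at time 0, mentions term values only up to
some time `N`. Since every `X` is nonempty, a model can be arranged so that `s =_X t` compares only
states at the same time. Refuting a formula thus amounts to finding a finite object, a quasimodel:
for each `i ≤ N` a set of types, i.e. truth assignments to a finite set `F i` of formulas. Its
conditions are local: Boolean clauses, a successor type, reflexivity and witnesses for the
quantifiers, and dependence laws (projection, transitivity, everything depends on all variables,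
compatibility with `○`).

A model yields a quasimodel by taking, at every time, the types of all its states
(`isQuasi_of_model`). Conversely, a quasimodel is unravelled into a model of timed paths. A step of
a path records which terms it preserves and the type it reaches; the dynamics advances the clock and
ages every step. The value of `y` consists of the time it refers to, its basic variable, and the
initial part of the path after which no step changes `y` (`rep`). If two states agree on a nonempty
`X`, their clocks agree and their paths branch off from a common path by steps preserving all of `X`
(`exists_common_append`). Since labels are closed under dependence, whatever `X` determines is then
the same at both states (`ValidPath.transfer`), and the truth lemma `PathState.model_sat` follows.
Beyond time `N` the path component of a value is erased, so the dynamics respects the identification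
of states with equal values.

For decidability, types and quasimodels over a given `F` are finite sets coded by the binary digits
of bounded numbers, so the search for a quasimodel is primitive recursive (`refutable`). A suitable
`F` is found by unbounded search, which always succeeds on codes of formulas (`exists_isClosed`);
whichever `F` is found gives the right answer (`refutable_iff_not_valid`). The arity function is
only computable, so the finitely many arities needed are supplied as a table. -/

namespace DFD

/-! ### Primitive recursive predicates and bounded quantifiers -/

/-- Primitive recursive functions, as a predicate for `fun_prop`. -/
@[fun_prop]
def PrimFun {α β : Type*} [Primcodable α] [Primcodable β] (f : α → β) : Prop := Primrec f

namespace PrimFun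

variable {α β γ : Type*} [Primcodable α] [Primcodable β] [Primcodable γ]

@[fun_prop]
theorem id : PrimFun (fun a : α => a) := Primrec.id

@[fun_prop]
theorem const (b : β) : PrimFun (fun _ : α => b) := Primrec.const b

@[fun_prop]
theorem comp {f : β → γ} {g : α → β} (hf : PrimFun f) (hg : PrimFun g) :
    PrimFun (fun a => f (g a)) := Primrec.comp hf hg

@[fun_prop]
theorem prodMk {f : α → β} {g : α → γ} (hf : PrimFun f) (hg : PrimFun g) :
    PrimFun (fun a => (f a, g a)) := Primrec.pair hf hg

@[fun_prop]
theorem fst {f : α → β × γ} (hf : PrimFun f) : PrimFun (fun a => (f a).1) := Primrec.fst.comp hf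

@[fun_prop]
theorem snd {f : α → β × γ} (hf : PrimFun f) : PrimFun (fun a => (f a).2) := Primrec.snd.comp hf

@[fun_prop]
theorem unpair {f : α → ℕ} (hf : PrimFun f) : PrimFun (fun a => (f a).unpair) :=
  Primrec.unpair.comp hf

@[fun_prop]
theorem pair {f g : α → ℕ} (hf : PrimFun f) (hg : PrimFun g) :
    PrimFun (fun a => Nat.pair (f a) (g a)) := Primrec₂.natPair.comp hf hg

@[fun_prop]
theorem add {f g : α → ℕ} (hf : PrimFun f) (hg : PrimFun g) :
    PrimFun (fun a => f a + g a) := Primrec.nat_add.comp hf hg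

@[fun_prop]
theorem sub {f g : α → ℕ} (hf : PrimFun f) (hg : PrimFun g) :
    PrimFun (fun a => f a - g a) := Primrec.nat_sub.comp hf hg

@[fun_prop]
theorem pow {f g : α → ℕ} (hf : PrimFun f) (hg : PrimFun g) :
    PrimFun (fun a => f a ^ g a) := by
  have h : Primrec fun a => (fun x => x * f a)^[g a] 1 :=
    Primrec.nat_iterate hg (Primrec.const 1)
      (Primrec.nat_mul.comp Primrec.snd (Primrec.comp hf Primrec.fst)).to₂
  refine h.of_eq fun a => ?_
  generalize g a = n
  induction n with
  | zero => rfl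
  | succ n ih => rw [Function.iterate_succ_apply', ih, pow_succ]

@[fun_prop]
theorem iterate {g : α → ℕ} {f : α → β} {h : β → β} (hh : PrimFun h) (hg : PrimFun g)
    (hf : PrimFun f) : PrimFun (fun a => h^[g a] (f a)) :=
  Primrec.nat_iterate hg hf (Primrec.comp hh Primrec.snd).to₂

@[fun_prop]
theorem testBit {f g : α → ℕ} (hf : PrimFun f) (hg : PrimFun g) :
    PrimFun (fun a => (f a).testBit (g a)) := by
  have h1 : Primrec fun a => f a / 2 ^ g a % 2 :=
    Primrec.nat_mod.comp (Primrec.nat_div.comp hf (pow (const 2) hg)) (Primrec.const 2)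
  have h2 := (Primrec.eq.comp h1 (Primrec.const 1)).decide
  exact h2.of_eq fun a => by rw [Nat.testBit_eq_decide_div_mod_eq]

@[fun_prop]
theorem and {f g : α → Bool} (hf : PrimFun f) (hg : PrimFun g) :
    PrimFun (fun a => f a && g a) := Primrec.and.comp hf hg

@[fun_prop]
theorem or {f g : α → Bool} (hf : PrimFun f) (hg : PrimFun g) :
    PrimFun (fun a => f a || g a) := Primrec.or.comp hf hg

@[fun_prop]
theorem not {f : α → Bool} (hf : PrimFun f) :
    PrimFun (fun a => !f a) := Primrec.not.comp hf

@[fun_prop]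
theorem beq {f g : α → ℕ} (hf : PrimFun f) (hg : PrimFun g) :
    PrimFun (fun a => f a == g a) :=
  (Primrec.beq.comp hf hg)

@[fun_prop]
theorem ble {f g : α → ℕ} (hf : PrimFun f) (hg : PrimFun g) :
    PrimFun (fun a => (f a).ble (g a)) :=
  (Primrec.nat_le.comp hf hg).decide.of_eq fun a => by
    rw [Bool.eq_iff_iff]; simp

end PrimFun

/-- Bounded universal quantification. -/
def allLt (n : ℕ) (f : ℕ → Bool) : Bool := decide (∀ x < n, f x = true)

/-- Bounded existential quantification. -/
def exLt (n : ℕ) (f : ℕ → Bool) : Bool := decide (∃ x < n, f x = true)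

/-- Boolean implication. -/
def imp (a b : Bool) : Bool := !a || b

/-- Boolean equivalence. -/
def biff (a b : Bool) : Bool := (!a || b) && (!b || a)

@[simp] theorem allLt_iff {n : ℕ} {f : ℕ → Bool} : allLt n f = true ↔ ∀ x < n, f x = true := by
  simp [allLt]

@[simp] theorem exLt_iff {n : ℕ} {f : ℕ → Bool} : exLt n f = true ↔ ∃ x < n, f x = true := by
  simp [exLt]

@[simp] theorem imp_iff {a b : Bool} : imp a b = true ↔ (a = true → b = true) := by
  cases a <;> cases b <;> simp [imp]

@[simp] theorem biff_iff {a b : Bool} : biff a b = true ↔ (a = true ↔ b = true) := by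
  cases a <;> cases b <;> simp [biff]

namespace PrimFun

variable {α β γ : Type*} [Primcodable α] [Primcodable β] [Primcodable γ]

@[fun_prop]
theorem imp {f g : α → Bool} (hf : PrimFun f) (hg : PrimFun g) :
    PrimFun (fun a => imp (f a) (g a)) := by
  unfold DFD.imp; fun_prop

@[fun_prop]
theorem biff {f g : α → Bool} (hf : PrimFun f) (hg : PrimFun g) :
    PrimFun (fun a => biff (f a) (g a)) := by
  unfold DFD.biff; fun_prop

@[fun_prop]
theorem allLt {n : α → ℕ} {f : α → ℕ → Bool} (hn : PrimFun n)
    (hf : PrimFun (fun p : α × ℕ => f p.1 p.2)) :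
    PrimFun (fun a => allLt (n a) (fun x => f a x)) := by
  have h : PrimrecRel fun (x : ℕ) (a : α) => f a x = true :=
    ⟨inferInstance, (hf.comp (prodMk (snd id) (fst id))).of_eq fun a => by simp⟩
  have h2 := PrimrecRel.comp (PrimrecRel.forall_mem_list h) (Primrec.list_range.comp hn) (Primrec.id (α := α))
  exact h2.decide.of_eq fun a => by simp [DFD.allLt]

@[fun_prop]
theorem exLt {n : α → ℕ} {f : α → ℕ → Bool} (hn : PrimFun n)
    (hf : PrimFun (fun p : α × ℕ => f p.1 p.2)) :
    PrimFun (fun a => exLt (n a) (fun x => f a x)) := by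
  have h : PrimrecRel fun (x : ℕ) (a : α) => f a x = true :=
    ⟨inferInstance, (hf.comp (prodMk (snd id) (fst id))).of_eq fun a => by simp⟩
  have h2 := PrimrecRel.comp (PrimrecRel.exists_mem_list h) (Primrec.list_range.comp hn) (Primrec.id (α := α))
  exact h2.decide.of_eq fun a => by simp [DFD.exLt]

end PrimFun

/-! ### Determined formulas, closed families and quasimodels -/

/-- The number of `○` in a term. -/
def Term.depth {V : Type*} : Term V → ℕ
  | .var _ => 0
  | .next x => x.depth + 1

/-- The basic variable a term is built from. -/
def Term.base {V : Type*} : Term V → V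
  | .var v => v
  | .next x => x.base

/-- The formula is an atom or a dependence formula whose truth value is a function of the values of
the terms in `L`. -/
def Formula.DetNow {V Pred : Type*} {ar : Pred → ℕ} (L : Term V → Prop) : Formula V ar → Prop
  | .atom _ x => ∀ j, L (x j)
  | .quant Z _ => ∀ z ∈ Z, L z
  | .dep Z _ => ∀ z ∈ Z, L z
  | _ => False

/-- The formulas `○^k χ`, with `χ` an atom or a dependence formula, whose truth value is a function
of the values of the terms in `L`. -/
def Formula.Det {V Pred : Type*} {ar : Pred → ℕ} (L : Term V → Prop) (ψ : Formula V ar) : Prop :=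
  ∃ (k : ℕ) (χ : Formula V ar), ψ = Formula.next^[k] χ ∧ χ.DetNow fun y => L (Term.next^[k] y)

theorem Formula.DetNow.mono {V Pred : Type*} {ar : Pred → ℕ} {L L' : Term V → Prop}
    {ψ : Formula V ar} (h : ψ.DetNow L) (hL : ∀ y, L y → L' y) : ψ.DetNow L' := by
  cases ψ with
  | atom P x => exact fun j => hL _ (h j)
  | quant Z _ => exact fun z hz => hL _ (h z hz)
  | dep Z _ => exact fun z hz => hL _ (h z hz)
  | _ => exact h

theorem Formula.Det.mono {V Pred : Type*} {ar : Pred → ℕ} {L L' : Term V → Prop}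
    {ψ : Formula V ar} (h : ψ.Det L) (hL : ∀ y, L y → L' y) : ψ.Det L' := by
  obtain ⟨k, χ, rfl, h⟩ := h
  exact ⟨k, χ, rfl, h.mono fun y => hL _⟩

theorem Formula.Det.next {V Pred : Type*} {ar : Pred → ℕ} {L : Term V → Prop}
    {ψ : Formula V ar} (h : ψ.Det fun y => L y.next) : ψ.next.Det L := by
  obtain ⟨k, χ, rfl, h⟩ := h
  refine ⟨k + 1, χ, (Function.iterate_succ_apply' _ _ _).symm, ?_⟩
  simpa only [Function.iterate_succ_apply'] using h

theorem Formula.Det.dep {V Pred : Type*} {ar : Pred → ℕ} {L : Term V → Prop}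
    {X : Finset (Term V)} (h : ∀ x ∈ X, L x) (y : Term V) :
    (Formula.dep X y : Formula V ar).Det L := ⟨0, _, rfl, h⟩

theorem Formula.Det.quant {V Pred : Type*} {ar : Pred → ℕ} {L : Term V → Prop}
    {X : Finset (Term V)} (h : ∀ x ∈ X, L x) (ψ : Formula V ar) :
    (Formula.quant X ψ).Det L := ⟨0, _, rfl, h⟩

theorem Formula.Det.atom {V Pred : Type*} {ar : Pred → ℕ} {L : Term V → Prop}
    {P : Pred} {x : Fin (ar P) → Term V} (h : ∀ j, L (x j)) :
    (Formula.atom P x : Formula V ar).Det L := ⟨0, _, rfl, h⟩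

/-- Closure conditions on a family of sets of formulas, indexed by the time `i ≤ N` at which they
are considered. Only terms denoting values at times up to `N` occur. -/
structure Closure {V Pred : Type*} {ar : Pred → ℕ} (F : ℕ → Formula V ar → Prop) (N : ℕ) :
    Prop where
  le_of : ∀ {i ψ}, F i ψ → i ≤ N
  atom : ∀ {i P x}, F i (.atom P x) → ∀ j, i + (x j).depth ≤ N
  -- Positive arity matters: an atom without arguments is vacuously of the shifted form, and the
  -- shift would push it past time `N`.
  atom_shift : ∀ {i P x}, F i (.atom P fun j => .next (x j)) → 0 < ar P → F (i + 1) (.atom P x)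
  neg : ∀ {i ψ}, F i (.neg ψ) → F i ψ
  and : ∀ {i ψ χ}, F i (.and ψ χ) → F i ψ ∧ F i χ
  next : ∀ {i ψ}, F i (.next ψ) ↔ F (i + 1) ψ
  quant : ∀ {i X ψ}, F i (.quant X ψ) → X.Nonempty ∧ (∀ x ∈ X, i + x.depth ≤ N) ∧ F i ψ
  dep : ∀ {i X y}, F i (.dep X y) ↔ X.Nonempty ∧ (∀ x ∈ X, i + x.depth ≤ N) ∧ i + y.depth ≤ N

/-- Quasimodels: at each time `i ≤ N` a set `Q i` of types, where `h a ψ` says that the formula `ψ`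
belongs to the type `a`. -/
structure QuasiModel {V Pred : Type*} {ar : Pred → ℕ} (F : ℕ → Formula V ar → Prop) (N : ℕ)
    {Ty : Type} (h : Ty → Formula V ar → Prop) (Q : ℕ → Ty → Prop) : Prop where
  sub : ∀ {i a ψ}, Q i a → h a ψ → F i ψ
  step : ∀ {i a}, i + 1 ≤ N → Q i a →
    ∃ b, Q (i + 1) b ∧ ∀ ψ, F (i + 1) ψ → (h b ψ ↔ h a (.next ψ))
  atom_next : ∀ {i a P x}, Q i a → F i (.atom P fun j => .next (x j)) → 0 < ar P →
    (h a (.atom P fun j => .next (x j)) ↔ h a (.next (.atom P x)))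
  -- An atom without arguments is not tied to any time, so all types at all times must agree on it.
  const : ∀ {i i' a b P x}, ar P = 0 → Q i a → Q i' b → F i (.atom P x) → F i' (.atom P x) →
    (h a (.atom P x) ↔ h b (.atom P x))
  neg : ∀ {i a ψ}, Q i a → F i (.neg ψ) → (h a (.neg ψ) ↔ ¬ h a ψ)
  and : ∀ {i a ψ χ}, Q i a → F i (.and ψ χ) → (h a (.and ψ χ) ↔ h a ψ ∧ h a χ)
  refl : ∀ {i a X ψ}, Q i a → F i (.quant X ψ) → h a (.quant X ψ) → h a ψ
  -- Types carry no values. A step to `b` will preserve exactly the terms that depend on `X`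
  -- according to `a`, so `b` has to agree with `a` on the formulas these terms determine.
  wit : ∀ {i a X ψ}, Q i a → F i (.quant X ψ) → ¬ h a (.quant X ψ) →
    ∃ b, Q i b ∧ ¬ h b ψ ∧ ∀ χ, F i χ → χ.Det (fun y => h a (.dep X y)) → (h a χ ↔ h b χ)
  dep_self : ∀ {i a X x}, Q i a → F i (.dep X x) → x ∈ X → h a (.dep X x)
  dep_trans : ∀ {i a X Z y}, Q i a → F i (.dep X y) → h a (.dep Z y) →
    (∀ z ∈ Z, h a (.dep X z)) → h a (.dep X y)
  -- This reflects that states are determined by the values of the basic variables.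
  dep_all : ∀ {i a X y}, Q i a → F i (.dep X y) → (∀ v, .var v ∈ X) → h a (.dep X y)
  dep_next : ∀ {i a X Z y}, Q i a → F i (.dep X (.next y)) → h a (.next (.dep Z y)) →
    (∀ z ∈ Z, .next z ∈ X) → h a (.dep X (.next y))

/-! ### Steps and paths over a quasimodel -/

/-- A step of a path: a set of (codes of) terms whose values are preserved and the type of the
target, both as they were `age` time units ago, when the step was made. -/
structure Step (Ty : Type) where
  age : ℕ
  label : Set ℕ
  type : Ty

namespace Step

variable {V : Type u} [Encodable V] {Pred : Type v} {ar : Pred → ℕ} {Ty : Type}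

/-- Passage of one time unit. -/
def tick (e : Step Ty) : Step Ty := ⟨e.age + 1, e.label, e.type⟩

theorem tick_injective : Function.Injective (tick (Ty := Ty)) := by
  rintro ⟨a, b, c⟩ ⟨a', b', c'⟩ h
  simpa [tick] using h

/-- The step currently preserves the value of `y`. -/
def Keeps (e : Step Ty) (y : Term V) : Prop := (Term.next^[e.age] y).code ∈ e.label

/-- The formula `ψ` is currently true at the target. -/
def Holds (h : Ty → Formula V ar → Prop) (e : Step Ty) (ψ : Formula V ar) : Prop :=
  h e.type (Formula.next^[e.age] ψ)

end Step

section Paths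

variable {V : Type u} [Encodable V] {Pred : Type v} {ar : Pred → ℕ} {Ty : Type}
  (F : ℕ → Formula V ar → Prop) (N : ℕ) (h : Ty → Formula V ar → Prop) (Q : ℕ → Ty → Prop)
  (a₀ : Ty)

/-- The formulas currently true at the end of a path at time `i`. -/
def pathType : ℕ → List (Step Ty) → Formula V ar → Prop
  | i, [], ψ => h a₀ (Formula.next^[i] ψ)
  | _, e :: _, ψ => e.Holds h ψ

/-- `A` is one of the types of the quasimodel at time `i`. -/
def IsType (i : ℕ) (A : Formula V ar → Prop) : Prop :=
  i ≤ N → ∃ b, Q i b ∧ ∀ ψ, A ψ ↔ h b ψ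

/-- The step `e` may be made at a state of type `A` at time `i`. -/
structure Link (i : ℕ) (A : Formula V ar → Prop) (e : Step Ty) : Prop where
  closed : ∀ Z y, F i (.dep Z y) → A (.dep Z y) → (∀ z ∈ Z, e.Keeps z) → e.Keeps y
  agree : ∀ χ, F i χ → χ.Det (fun y => e.Keeps y) → (A χ ↔ e.Holds h χ)
  isType : IsType N h Q i (e.Holds h)

/-- Legitimate paths at time `i`, with the last step first. -/
def ValidPath (i : ℕ) : List (Step Ty) → Prop
  | [] => IsType N h Q i (pathType h a₀ i [])
  | e :: π => ValidPath i π ∧ Link F N h Q i (pathType h a₀ i π) e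

variable {F N h Q a₀}

theorem pathType_tick (i : ℕ) (π : List (Step Ty)) (ψ : Formula V ar) :
    pathType h a₀ (i + 1) (π.map Step.tick) ψ ↔ pathType h a₀ i π (.next ψ) := by
  cases π <;> exact Iff.rfl

theorem ValidPath.isType {i : ℕ} {π : List (Step Ty)} (hπ : ValidPath F N h Q a₀ i π) :
    IsType N h Q i (pathType h a₀ i π) := by
  cases π with
  | nil => exact hπ
  | cons e π => exact hπ.2.isType

theorem IsType.next (hF : Closure F N) (hQ : QuasiModel F N h Q) {i : ℕ}
    {A : Formula V ar → Prop} (hA : IsType N h Q i A) :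
    IsType N h Q (i + 1) fun ψ => A (.next ψ) := by
  intro hi
  obtain ⟨a, ha, hAa⟩ := hA (by omega)
  obtain ⟨b, hb, hab⟩ := hQ.step hi ha
  refine ⟨b, hb, fun ψ => ?_⟩
  refine (hAa _).trans ?_
  exact ⟨fun h1 => (hab ψ (hF.next.1 (hQ.sub ha h1))).2 h1, fun h1 => (hab ψ (hQ.sub hb h1)).1 h1⟩

/-- After a tick, preserving `y` means that `○y` was preserved before. Closure under `D_Z y` is
therefore closure under `D_{○Z} ○y` one time unit earlier, which `dep_next` extracts from `○ D_Z y`.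
Agreement survives because determined formulas are stable under prefixing `○`; this is why
`Formula.Det` admits iterated `○`. -/
theorem Link.tick (hF : Closure F N) (hQ : QuasiModel F N h Q) {i : ℕ}
    {A : Formula V ar → Prop} (hA : IsType N h Q i A) {e : Step Ty} (he : Link F N h Q i A e) :
    Link F N h Q (i + 1) (fun ψ => A (.next ψ)) e.tick where
  closed Z y hZ hA' hz := by
    classical
    have hi := hF.le_of hZ
    obtain ⟨a, ha, hAa⟩ := hA (by omega)
    obtain ⟨h1, h2, h3⟩ := hF.dep.1 hZ
    have hX : F i (.dep (Z.image .next) y.next) := by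
      refine hF.dep.2 ⟨h1.image _, ?_, by simp only [Term.depth]; omega⟩
      intro x hx
      obtain ⟨z, hz, rfl⟩ := Finset.mem_image.1 hx
      have := h2 z hz
      simp only [Term.depth]; omega
    refine he.closed (Z.image .next) y.next hX ?_ ?_
    · exact (hAa _).2 (hQ.dep_next ha hX ((hAa _).1 hA') fun z hz => Finset.mem_image_of_mem _ hz)
    · intro x hx
      obtain ⟨z, hz', rfl⟩ := Finset.mem_image.1 hx
      exact hz z hz'
  agree χ hχ hd := he.agree _ (hF.next.2 hχ) hd.next
  isType := he.isType.next hF hQ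

theorem ValidPath.tick (hF : Closure F N) (hQ : QuasiModel F N h Q) {i : ℕ}
    {π : List (Step Ty)} (hπ : ValidPath F N h Q a₀ i π) :
    ValidPath F N h Q a₀ (i + 1) (π.map Step.tick) := by
  induction π with
  | nil => exact IsType.next hF hQ hπ
  | cons e π ih =>
    refine ⟨ih hπ.1, ?_⟩
    have := hπ.2.tick hF hQ hπ.1.isType
    simpa only [← pathType_tick] using this

open Classical in
/-- The shortest initial part of a path along whose remainder the value of `y` is constant. -/
noncomputable def rep (y : Term V) (π : List (Step Ty)) : List (Step Ty) :=
  π.dropWhile fun e => decide (e.Keeps y)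

theorem rep_tick (y : Term V) (π : List (Step Ty)) :
    rep y (π.map Step.tick) = (rep y.next π).map Step.tick := by
  unfold rep
  rw [List.dropWhile_map]
  rfl

theorem rep_cons_of_keeps {y : Term V} {e : Step Ty} (he : e.Keeps y) (π : List (Step Ty)) :
    rep y (e :: π) = rep y π := by
  simp [rep, he]

theorem rep_cons_of_not_keeps {y : Term V} {e : Step Ty} (he : ¬ e.Keeps y) (π : List (Step Ty)) :
    rep y (e :: π) = e :: π := by
  simp [rep, he]

theorem rep_append {y : Term V} {α : List (Step Ty)} (hα : ∀ e ∈ α, e.Keeps y)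
    (σ : List (Step Ty)) : rep y (α ++ σ) = rep y σ := by
  induction α with
  | nil => rfl
  | cons e α ih =>
    rw [List.cons_append, rep_cons_of_keeps (hα e (by simp)), ih fun e he => hα e (by simp [he])]

theorem length_rep_le (y : Term V) (π : List (Step Ty)) : (rep y π).length ≤ π.length :=
  (List.dropWhile_suffix _).length_le

/-- A shorter `rep x π` means a longer run of recent steps preserving `x`. The run for `x₀`, whose
`rep` is longest, is thus contained in the run for each `x ∈ X`. -/
theorem exists_append_rep (X : Finset (Term V)) (x₀ : Term V) (π : List (Step Ty))
    (hX : ∀ x ∈ X, (rep x π).length ≤ (rep x₀ π).length) :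
    ∃ α, π = α ++ rep x₀ π ∧ ∀ e ∈ α, ∀ x ∈ X, e.Keeps x := by
  classical
  refine ⟨π.takeWhile fun e => decide (e.Keeps x₀), (List.takeWhile_append_dropWhile ..).symm, ?_⟩
  intro e he x hx
  have h1 : (π.takeWhile fun e => decide (e.Keeps x₀)) <+: π.takeWhile fun e => decide (e.Keeps x) := by
    refine List.prefix_of_prefix_length_le (List.takeWhile_prefix _) (List.takeWhile_prefix _) ?_
    have h2 := congrArg List.length (List.takeWhile_append_dropWhile
      (p := fun e : Step Ty => decide (e.Keeps x₀)) (l := π))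
    have h3 := congrArg List.length (List.takeWhile_append_dropWhile
      (p := fun e : Step Ty => decide (e.Keeps x)) (l := π))
    have h4 := hX x hx
    simp only [rep] at h4
    rw [List.length_append] at h2 h3
    omega
  simpa using List.mem_takeWhile_imp (h1.subset he)

/-- The branching point is `rep x₀` for the `x₀ ∈ X` that maximizes its length, i.e. the term of `X`
changed most recently. Nonemptiness of `X` is needed for such a term to exist. -/
theorem exists_common_append {X : Finset (Term V)} (hX : X.Nonempty) {π π' : List (Step Ty)}
    (hπ : ∀ x ∈ X, rep x π = rep x π') :
    ∃ σ α β, π = α ++ σ ∧ π' = β ++ σ ∧ (∀ e ∈ α, ∀ x ∈ X, e.Keeps x) ∧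
      ∀ e ∈ β, ∀ x ∈ X, e.Keeps x := by
  obtain ⟨x₀, hx₀, hmax⟩ := X.exists_max_image (fun x => (rep x π).length) hX
  obtain ⟨α, hα, hα'⟩ := exists_append_rep X x₀ π hmax
  obtain ⟨β, hβ, hβ'⟩ := exists_append_rep X x₀ π' fun x hx => by
    rw [← hπ x hx, ← hπ x₀ hx₀]; exact hmax x hx
  exact ⟨rep x₀ π, α, β, hα, by rw [hπ x₀ hx₀]; exact hβ, hα', hβ'⟩

theorem ValidPath.append {i : ℕ} {X : Finset (Term V)} {α σ : List (Step Ty)}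
    (hπ : ValidPath F N h Q a₀ i (α ++ σ)) (hα : ∀ e ∈ α, ∀ x ∈ X, e.Keeps x) :
    (∀ χ, F i χ → χ.Det (fun x => x ∈ X) →
      (pathType h a₀ i (α ++ σ) χ ↔ pathType h a₀ i σ χ)) ∧
    ∀ y, F i (.dep X y) → pathType h a₀ i σ (.dep X y) → ∀ e ∈ α, e.Keeps y := by
  induction α with
  | nil => simp
  | cons e α ih =>
    obtain ⟨h1, h2⟩ := ih hπ.1 fun e he => hα e (by simp [he])
    have he := hα e (by simp)
    refine ⟨fun χ hχ hd => ?_, fun y hy hσ e' he' => ?_⟩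
    · rw [← h1 χ hχ hd]
      exact (hπ.2.agree χ hχ (hd.mono he)).symm
    · rcases List.mem_cons.1 he' with rfl | he'
      · exact hπ.2.closed X y hy ((h1 _ hy (.dep (fun _ h => h) y)).2 hσ) he
      · exact h2 y hy hσ e' he'

/-- Information travels from `π` back to the common branching point and out again to `π'`, along
steps that all preserve `X`. A `y` with `D_X y` true at the branching point is preserved along both
branches, so its `rep` is that of the branching point. -/
theorem ValidPath.transfer {i : ℕ} {X : Finset (Term V)} (hX : X.Nonempty)
    {π π' : List (Step Ty)} (hπ : ValidPath F N h Q a₀ i π) (hπ' : ValidPath F N h Q a₀ i π')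
    (heq : ∀ x ∈ X, rep x π = rep x π') :
    (∀ χ, F i χ → χ.Det (fun x => x ∈ X) →
      (pathType h a₀ i π χ ↔ pathType h a₀ i π' χ)) ∧
    ∀ y, F i (.dep X y) → pathType h a₀ i π (.dep X y) → rep y π = rep y π' := by
  obtain ⟨σ, α, β, rfl, rfl, hα, hβ⟩ := exists_common_append hX heq
  obtain ⟨h1, h2⟩ := hπ.append hα
  obtain ⟨h3, h4⟩ := hπ'.append hβ
  refine ⟨fun χ hχ hd => (h1 χ hχ hd).trans (h3 χ hχ hd).symm, fun y hy hd => ?_⟩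
  have hd' := (h1 _ hy (.dep (fun _ h => h) y)).1 hd
  rw [rep_append (h2 y hy hd'), rep_append (h4 y hy hd')]

/-- The step to a state of type `b` along which exactly the values determined by those of the terms
in `X` are preserved. -/
def newStep (A : Formula V ar → Prop) (X : Finset (Term V)) (b : Ty) : Step Ty :=
  ⟨0, {n | ∃ y : Term V, y.code = n ∧ A (.dep X y)}, b⟩

theorem newStep_keeps {A : Formula V ar → Prop} {X : Finset (Term V)} {b : Ty} {y : Term V} :
    (newStep A X b).Keeps y ↔ A (.dep X y) := by
  constructor
  · rintro ⟨y', h1, h2⟩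
    obtain rfl : y' = y := Term.code_injective h1
    exact h2
  · exact fun h1 => ⟨y, rfl, h1⟩

/-- The label of the new step is closed under dependence by transitivity: if `X` determines every `z
∈ Z` and `Z` determines `y`, then `X` determines `y`. -/
theorem ValidPath.cons_newStep (hF : Closure F N) (hQ : QuasiModel F N h Q) {i : ℕ}
    {X : Finset (Term V)} (hX : X.Nonempty) (hXi : ∀ x ∈ X, i + x.depth ≤ N) {b : Ty}
    {π : List (Step Ty)} (hπ : ValidPath F N h Q a₀ i π) (hb : Q i b)
    (hd : ∀ χ, F i χ → χ.Det (fun y => pathType h a₀ i π (.dep X y)) →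
      (pathType h a₀ i π χ ↔ h b χ)) :
    ValidPath F N h Q a₀ i (newStep (pathType h a₀ i π) X b :: π) := by
  refine ⟨hπ, ⟨fun Z y hZ hA hz => ?_, fun χ hχ hd' => ?_, fun _ => ⟨b, hb, fun _ => Iff.rfl⟩⟩⟩
  · simp only [newStep_keeps] at hz ⊢
    obtain ⟨a, ha, hAa⟩ := hπ.isType (hF.le_of hZ)
    simp only [hAa] at hz hA ⊢
    exact hQ.dep_trans ha (hF.dep.2 ⟨hX, hXi, (hF.dep.1 hZ).2.2⟩) hA hz
  · exact hd χ hχ (hd'.mono fun y => newStep_keeps.1)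

end Paths

theorem Term.ext_depth_base {V : Type*} {x y : Term V} (h1 : x.depth = y.depth)
    (h2 : x.base = y.base) : x = y := by
  induction x generalizing y with
  | var v =>
    cases y with
    | var w => exact congrArg _ h2
    | next y => simp [Term.depth] at h1
  | next x ih =>
    cases y with
    | var w => simp [Term.depth] at h1
    | next y => exact congrArg _ (ih (by simpa [Term.depth] using h1) h2)

/-! ### The path model and the truth lemma -/

section PathModel

variable {V : Type u} [Encodable V] {Pred : Type v} {ar : Pred → ℕ} {Ty : Type}
  (F : ℕ → Formula V ar → Prop) (N : ℕ) (h : Ty → Formula V ar → Prop) (Q : ℕ → Ty → Prop)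
  (a₀ : Ty)

/-- States of the path model, before identification of states with the same values. -/
structure PathState where
  time : ℕ
  path : List (Step Ty)
  valid : ValidPath F N h Q a₀ time path

variable {F N h Q a₀}

namespace PathState

/-- The formulas that are to be true at a state. -/
def type (s : PathState F N h Q a₀) : Formula V ar → Prop := pathType h a₀ s.time s.path

/-- The value of a term at a state of the path model. -/
noncomputable def termVal (y : Term V) (s : PathState F N h Q a₀) : ℕ × ℕ × List (Step Ty) :=
  (s.time + y.depth, Encodable.encode y.base,
    if s.time + y.depth ≤ N then (rep y s.path).map Step.tick^[y.depth] else [])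

theorem termVal_eq_iff {y : Term V} {s t : PathState F N h Q a₀} (ht : s.time = t.time)
    (hy : s.time + y.depth ≤ N) : s.termVal y = t.termVal y ↔ rep y s.path = rep y t.path := by
  have hy' : t.time + y.depth ≤ N := ht ▸ hy
  simp only [termVal, hy', if_true, ht, Prod.mk.injEq, true_and]
  exact (List.map_injective_iff.2 (Step.tick_injective.iterate _)).eq_iff

/-- Values carry the time they refer to, so one common term synchronizes the clocks. This is where
dependence on the empty set has to be excluded. -/
theorem time_eq {X : Finset (Term V)} (hX : X.Nonempty) {s t : PathState F N h Q a₀}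
    (hst : ∀ x ∈ X, s.termVal x = t.termVal x) : s.time = t.time := by
  obtain ⟨x, hx⟩ := hX
  have := congrArg Prod.fst (hst x hx)
  simpa [termVal] using this

theorem transfer {X : Finset (Term V)} (hX : X.Nonempty) {s t : PathState F N h Q a₀}
    (hXs : ∀ x ∈ X, s.time + x.depth ≤ N) (hst : ∀ x ∈ X, s.termVal x = t.termVal x) :
    (∀ χ, F s.time χ → χ.Det (fun x => x ∈ X) → (s.type χ ↔ t.type χ)) ∧
    ∀ y, F s.time (.dep X y) → s.type (.dep X y) → rep y s.path = rep y t.path := by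
  have ht := time_eq hX hst
  have h1 := s.valid.transfer hX (ht ▸ t.valid) fun x hx =>
    (termVal_eq_iff ht (hXs x hx)).1 (hst x hx)
  unfold type
  rw [← ht]
  exact h1

variable (hF : Closure F N) (hQ : QuasiModel F N h Q)

/-- The dynamics of the path model. -/
def succ (hF : Closure F N) (hQ : QuasiModel F N h Q) (s : PathState F N h Q a₀) :
    PathState F N h Q a₀ :=
  ⟨s.time + 1, s.path.map Step.tick, s.valid.tick hF hQ⟩

theorem type_succ (s : PathState F N h Q a₀) (ψ : Formula V ar) :
    (s.succ hF hQ).type ψ ↔ s.type (.next ψ) := pathType_tick _ _ _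

/-- The three components of a value are designed for this: the clock gains what the depth loses, and
the ageing of the path is made up for by the ticks applied in `termVal`. -/
theorem termVal_succ (s : PathState F N h Q a₀) (y : Term V) :
    (s.succ hF hQ).termVal y = s.termVal y.next := by
  have : s.time + 1 + y.depth = s.time + (y.depth + 1) := by omega
  simp only [termVal, succ, Term.depth, Term.base, rep_tick, List.map_map, this]
  rfl

include hF hQ in
theorem exists_termVal_base (y : Term V) (s : PathState F N h Q a₀) :
    ∃ t : PathState F N h Q a₀, s.termVal y = t.termVal (.var y.base) := by
  induction y generalizing s with
  | var v => exact ⟨s, rfl⟩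
  | next y ih =>
    obtain ⟨t, ht⟩ := ih (s.succ hF hQ)
    exact ⟨t, by rw [← termVal_succ hF hQ, ht]; rfl⟩

/-- Within the horizon, `D_X ○v` holds for `X` the set of all variables by `dep_all`, so agreement
on all variables passes to `○v`. -/
theorem succ_agree [Finite V] {s t : PathState F N h Q a₀}
    (hst : ∀ v : V, s.termVal (.var v) = t.termVal (.var v)) (v : V) :
    (s.succ hF hQ).termVal (.var v) = (t.succ hF hQ).termVal (.var v) := by
  classical
  have := Fintype.ofFinite V
  rw [termVal_succ, termVal_succ]
  let X : Finset (Term V) := Finset.univ.image Term.var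
  have hX : X.Nonempty := ⟨.var v, Finset.mem_image_of_mem _ (Finset.mem_univ v)⟩
  have hst' : ∀ x ∈ X, s.termVal x = t.termVal x := by
    intro x hx
    obtain ⟨v, -, rfl⟩ := Finset.mem_image.1 hx
    exact hst v
  have ht := time_eq hX hst'
  by_cases hs : s.time + 1 ≤ N
  · have hXs : ∀ x ∈ X, s.time + x.depth ≤ N := by
      intro x hx
      obtain ⟨v, -, rfl⟩ := Finset.mem_image.1 hx
      simp only [Term.depth]; omega
    have hy : F s.time (.dep X (.next (.var v))) := hF.dep.2 ⟨hX, hXs, hs⟩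
    refine (termVal_eq_iff (y := .next (.var v)) ht hs).2 ((transfer hX hXs hst').2 _ hy ?_)
    obtain ⟨a, ha, hA⟩ := s.valid.isType (by omega)
    exact (hA _).2 (hQ.dep_all ha hy fun v => Finset.mem_image_of_mem _ (Finset.mem_univ v))
  -- Past the horizon the path components of both values are `[]`, and only the equal clocks remain.
  · have hs' : ¬ t.time + 1 ≤ N := ht ▸ hs
    simp [termVal, Term.depth, hs', ht]

include hF hQ in
-- Equal values force equal `time + depth` and equal base variable. If `s` lags behind by `d`, every
-- argument at `s` therefore starts with `○`; moving `s` forward strips it, by `atom_next`. At equal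
-- times the argument tuples are literally the same, and `transfer` applies.
theorem atom_iff_of_le {P : Pred} (hP : 0 < ar P) (d : ℕ) {s t : PathState F N h Q a₀}
    (hd : s.time + d = t.time) {x x' : Fin (ar P) → Term V} (hx : F s.time (.atom P x))
    (hx' : F t.time (.atom P x')) (heq : ∀ j, s.termVal (x j) = t.termVal (x' j)) :
    s.type (.atom P x) ↔ t.type (.atom P x') := by
  classical
  induction d generalizing s x with
  | zero =>
    obtain rfl : x = x' := by
      funext j
      have h1 := heq j
      simp only [termVal, Prod.mk.injEq, Encodable.encode_inj] at h1
      exact Term.ext_depth_base (by omega) h1.2.1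
    refine (transfer (X := Finset.univ.image x) ⟨x ⟨0, hP⟩, by simp⟩ ?_ ?_).1 _ hx
      (.atom fun j => by simp)
    · simpa using hF.atom hx
    · simpa using heq
  | succ d ih =>
    have hy : ∃ y : Fin (ar P) → Term V, x = fun j => .next (y j) := by
      have h1 : ∀ j, ∃ y, x j = .next y := by
        intro j
        have h1 := heq j
        simp only [termVal, Prod.mk.injEq] at h1
        cases hxj : x j with
        | var v => rw [hxj] at h1; simp only [Term.depth] at h1; omega
        | next y => exact ⟨y, rfl⟩
      choose y hy using h1
      exact ⟨y, funext hy⟩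
    obtain ⟨y, rfl⟩ := hy
    obtain ⟨a, ha, hA⟩ := s.valid.isType (hF.le_of hx)
    rw [← ih (s := s.succ hF hQ) (x := y) (by rw [← hd]; simp only [succ]; omega)
      (hF.atom_shift hx hP) fun j => by rw [termVal_succ, heq]]
    rw [type_succ, type, hA, hA]
    exact hQ.atom_next ha hx hP

include hF hQ in
theorem atom_iff {P : Pred} {s t : PathState F N h Q a₀}
    {x x' : Fin (ar P) → Term V} (hx : F s.time (.atom P x))
    (hx' : F t.time (.atom P x')) (heq : ∀ j, s.termVal (x j) = t.termVal (x' j)) :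
    s.type (.atom P x) ↔ t.type (.atom P x') := by
  rcases Nat.eq_zero_or_pos (ar P) with hP | hP
  · obtain rfl : x = x' := by
      funext j
      exact absurd j.2 (by omega)
    obtain ⟨a, ha, hA⟩ := s.valid.isType (hF.le_of hx)
    obtain ⟨b, hb, hB⟩ := t.valid.isType (hF.le_of hx')
    rw [type, type, hA, hB]
    exact hQ.const hP ha hb hx hx'
  · rcases Nat.le_total s.time t.time with hst | hst
    · exact atom_iff_of_le hF hQ hP (t.time - s.time) (by omega) hx hx' heq
    · exact (atom_iff_of_le hF hQ hP (s.time - t.time) (by omega) hx' hx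
        fun j => (heq j).symm).symm

variable (F N h Q a₀) in
/-- States with the same values of the basic variables. -/
def setoid : Setoid (ULift.{w} (PathState F N h Q a₀)) where
  r s t := ∀ v : V, s.down.termVal (.var v) = t.down.termVal (.var v)
  iseqv := ⟨fun _ _ => rfl, fun h1 v => (h1 v).symm, fun h1 h2 v => (h1 v).trans (h2 v)⟩

/-- The path model. -/
noncomputable def model [Finite V] (hF : Closure F N) (hQ : QuasiModel F N h Q) (a₀ : Ty) :
    DynModel.{u, v, w} V ar where
  S := Quotient (setoid.{u, v, w} F N h Q a₀)
  g := Quotient.map (fun s => ⟨s.down.succ hF hQ⟩) fun _ _ hst v => succ_agree hF hQ hst v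
  U := ULift.{w} (ℕ × ℕ × List (Step Ty))
  D v := {a | ∃ s : PathState F N h Q a₀, a = ⟨s.termVal (.var v)⟩}
  I P := {a | ∃ (s : PathState F N h Q a₀) (x : Fin (ar P) → Term V),
    (∀ j, a j = ⟨s.termVal (x j)⟩) ∧ F s.time (.atom P x) ∧ s.type (.atom P x)}
  I_subset P a := by
    rintro ⟨s, x, ha, -, -⟩ j
    obtain ⟨t, ht⟩ := exists_termVal_base hF hQ (x j) s
    exact Set.mem_iUnion.2 ⟨(x j).base, t, by rw [ha, ht]⟩
  val v := Quotient.lift (fun s => ⟨⟨s.down.termVal (.var v)⟩, s.down, rfl⟩)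
    fun s t hst => by simp only [hst v]
  state_ext s t := by
    induction s using Quotient.inductionOn
    induction t using Quotient.inductionOn
    intro hst
    refine Quotient.sound fun v => ?_
    have := congrArg (fun a => a.1.down) (hst v)
    exact this

/-- The state of the path model given by a path. -/
def toModel [Finite V] (hF : Closure F N) (hQ : QuasiModel F N h Q) (s : PathState F N h Q a₀) :
    (model.{u, v, w} hF hQ a₀).S := Quotient.mk (setoid F N h Q a₀) ⟨s⟩

theorem model_g [Finite V] (s : PathState F N h Q a₀) :
    (model.{u, v, w} hF hQ a₀).g (s.toModel hF hQ) = (s.succ hF hQ).toModel hF hQ := rfl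

theorem model_termVal [Finite V] (y : Term V) (s : PathState F N h Q a₀) :
    (model.{u, v, w} hF hQ a₀).termVal y (s.toModel hF hQ) = ⟨s.termVal y⟩ := by
  induction y generalizing s with
  | var v => rfl
  | next y ih =>
    rw [DynModel.termVal, model_g, ih, termVal_succ]

theorem model_agree [Finite V] (X : Finset (Term V)) (s t : PathState F N h Q a₀) :
    (model.{u, v, w} hF hQ a₀).Agree X (s.toModel hF hQ) (t.toModel hF hQ) ↔
      ∀ x ∈ X, s.termVal x = t.termVal x := by
  simp only [DynModel.Agree, model_termVal]
  exact ⟨fun h1 x hx => congrArg ULift.down (h1 x hx), fun h1 x hx => by rw [h1 x hx]⟩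

/-- A tuple is put into `I P` as soon as some state at some time asks for it; `atom_iff` guarantees
that no other state objects. False quantified formulas and false dependence atoms are refuted by
adding one new step to the path, and true ones are handled by `transfer`. -/
theorem model_sat [Finite V] (ψ : Formula V ar) (s : PathState F N h Q a₀) (hψ : F s.time ψ) :
    (model.{u, v, w} hF hQ a₀).Sat ψ (s.toModel hF hQ) ↔ s.type ψ := by
  induction ψ generalizing s with
  | atom P x =>
    simp only [DynModel.Sat, model_termVal]
    constructor
    · rintro ⟨t, x', h1, ht, h2⟩
      exact (atom_iff hF hQ hψ ht fun j => congrArg ULift.down (h1 j)).2 h2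
    · exact fun h1 => ⟨s, x, fun _ => rfl, hψ, h1⟩
  | neg φ ih =>
    obtain ⟨a, ha, hA⟩ := s.valid.isType (hF.le_of hψ)
    rw [DynModel.Sat, ih s (hF.neg hψ), type, hA, hA, hQ.neg ha hψ]
  | and φ χ ih₁ ih₂ =>
    obtain ⟨a, ha, hA⟩ := s.valid.isType (hF.le_of hψ)
    rw [DynModel.Sat, ih₁ s (hF.and hψ).1, ih₂ s (hF.and hψ).2, type, hA, hA, hA, hQ.and ha hψ]
  | next φ ih =>
    rw [DynModel.Sat, model_g, ih _ (hF.next.1 hψ), type_succ]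
  | quant X φ ih =>
    obtain ⟨hX, hXs, hφ⟩ := hF.quant hψ
    rw [DynModel.Sat]
    constructor
    · intro h1
      by_contra h2
      obtain ⟨a, ha, hA⟩ := s.valid.isType (hF.le_of hψ)
      obtain ⟨b, hb, hbφ, hd⟩ := hQ.wit ha hψ (fun h3 => h2 ((hA _).2 h3))
      let t : PathState F N h Q a₀ := ⟨s.time, newStep s.type X b :: s.path,
        s.valid.cons_newStep hF hQ hX hXs hb fun χ hχ hd' =>
          (hA χ).trans (hd χ hχ (hd'.mono fun y hy => (hA _).1 hy))⟩
      have h3 := h1 (t.toModel hF hQ) ((model_agree hF hQ X s t).2 fun x hx => by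
        refine (termVal_eq_iff (s := s) (t := t) rfl (hXs x hx)).2 (rep_cons_of_keeps ?_ _).symm
        exact newStep_keeps.2 ((hA _).2 (hQ.dep_self ha (hF.dep.2 ⟨hX, hXs, hXs x hx⟩) hx)))
      exact hbφ ((ih t hφ).1 h3)
    · intro h1 t' hst
      induction t' using Quotient.inductionOn with
      | _ t =>
      obtain ⟨t⟩ := t
      have hst := (model_agree hF hQ X s t).1 hst
      have ht := time_eq hX hst
      obtain ⟨b, hb, hB⟩ := t.valid.isType (ht ▸ hF.le_of hψ)
      -- The truth of `𝖣_X φ` is itself determined by `X`, so it moves to `t` and reflexivity gives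
      -- `φ` there.
      have h2 := ((transfer hX hXs hst).1 _ hψ (.quant (fun _ h => h) φ)).1 h1
      exact (ih t (ht ▸ hφ)).2 ((hB _).2 (hQ.refl hb (ht ▸ hψ) ((hB _).1 h2)))
  | dep X y =>
    obtain ⟨hX, hXs, hy⟩ := hF.dep.1 hψ
    rw [DynModel.Sat]
    constructor
    · intro h1
      by_contra h2
      obtain ⟨a, ha, hA⟩ := s.valid.isType (hF.le_of hψ)
      -- The counterexample is a copy of `s` with the same type, at which everything not determined
      -- by `X` gets a fresh value.
      let t : PathState F N h Q a₀ := ⟨s.time, newStep s.type X a :: s.path,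
        s.valid.cons_newStep hF hQ hX hXs ha fun χ _ _ => hA χ⟩
      have h3 := h1 (t.toModel hF hQ) ((model_agree hF hQ X s t).2 fun x hx => by
        refine (termVal_eq_iff (s := s) (t := t) rfl (hXs x hx)).2 (rep_cons_of_keeps ?_ _).symm
        exact newStep_keeps.2 ((hA _).2 (hQ.dep_self ha (hF.dep.2 ⟨hX, hXs, hXs x hx⟩) hx)))
      rw [model_termVal, model_termVal] at h3
      have h4 := (termVal_eq_iff (s := s) (t := t) rfl hy).1 (congrArg ULift.down h3)
      -- The new step changes `y`, so the `rep` of `y` is the whole new path, which is too long to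
      -- be a part of the old one.
      have h5 : rep y t.path = newStep s.type X a :: s.path :=
        rep_cons_of_not_keeps (fun h5 => h2 (newStep_keeps.1 h5)) _
      have h6 := length_rep_le y s.path
      rw [h4, h5] at h6
      simp at h6
    · intro h1 t' hst
      induction t' using Quotient.inductionOn with
      | _ t =>
      obtain ⟨t⟩ := t
      have hst := (model_agree hF hQ X s t).1 hst
      have h2 := (termVal_eq_iff (time_eq hX hst) hy).2 ((transfer hX hXs hst).2 y hψ h1)
      change (model.{u, v, w} hF hQ a₀).termVal y _ =
        (model.{u, v, w} hF hQ a₀).termVal y (t.toModel hF hQ)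
      rw [model_termVal, model_termVal, h2]

end PathState

theorem QuasiModel.exists_model [Finite V] (hF : Closure F N) (hQ : QuasiModel F N h Q)
    {a : Ty} (ha : Q 0 a) {φ : Formula V ar} (hφ : F 0 φ) (haφ : ¬ h a φ) :
    ¬ Formula.Valid.{u, v, w} φ := by
  intro hv
  let s : PathState F N h Q a := ⟨0, [], fun _ => ⟨a, ha, fun _ => Iff.rfl⟩⟩
  exact haφ ((PathState.model_sat hF hQ φ s hφ).1 (hv _ _))

end PathModel

/-! ### Recognizing codes of terms and formulas -/

namespace PrimFun

variable {α : Type*} [Primcodable α]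

@[fun_prop]
theorem ofNatList {f : α → ℕ} (hf : PrimFun f) :
    PrimFun fun a => Denumerable.ofNat (List ℕ) (f a) := (Primrec.ofNat (List ℕ)).comp hf

@[fun_prop]
theorem length {f : α → List ℕ} (hf : PrimFun f) : PrimFun fun a => (f a).length :=
  Primrec.list_length.comp hf

@[fun_prop]
theorem getD {f : α → List ℕ} {g : α → ℕ} (hf : PrimFun f) (hg : PrimFun g) :
    PrimFun fun a => (f a).getD (g a) 0 := (Primrec.list_getD 0).comp hf hg

theorem encodeList {f : α → List ℕ} (hf : PrimFun f) :
    PrimFun fun a => Encodable.encode (f a) := Primrec.encode.comp hf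

theorem map {f : α → List ℕ} {g : ℕ → ℕ} (hf : PrimFun f) (hg : PrimFun g) :
    PrimFun fun a => (f a).map g := Primrec.list_map hf (Primrec.comp hg Primrec.snd).to₂

end PrimFun

/-- Membership of the pair `(i, x)` in the set coded by `S`. -/
def has (i x S : ℕ) : Bool := S.testBit (Nat.pair i x)

/-- The number of arguments of the atom `Nat.pair 0 r`. -/
def argLen (r : ℕ) : ℕ := (Denumerable.ofNat (List ℕ) r.unpair.2).length

/-- The arguments of the atom `Nat.pair 0 r`. -/
def argAt (r j : ℕ) : ℕ := (Denumerable.ofNat (List ℕ) r.unpair.2).getD j 0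

/-- Deletes the outermost `○` in the arguments of the atom `Nat.pair 0 r`. -/
def unshift (r : ℕ) : ℕ :=
  Nat.pair 0 (Nat.pair r.unpair.1 (Encodable.encode
    ((Denumerable.ofNat (List ℕ) r.unpair.2).map fun y => y.unpair.2)))

/-- The `n`-th entry of the list coded by `tb`. -/
def entry (tb n : ℕ) : ℕ := (Denumerable.ofNat (List ℕ) tb).getD n 0

/-- Recognizes codes of terms, given the set `vm` of codes of variables. -/
def isTm (vm x : ℕ) : Bool :=
  exLt (2 ^ (x + 1)) fun S => S.testBit x && allLt (x + 1) fun y => imp (S.testBit y)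
    (vm.testBit y || (y.unpair.1 == 1 && S.testBit y.unpair.2))

/-- Recognizes codes of nonempty sets of terms. -/
def isSet (vm X : ℕ) : Bool := !(X == 0) && allLt X fun z => imp (X.testBit z) (isTm vm z)

/-- Recognizes codes of formulas without empty dependence sets; the `n`-th entry of the list
coded by `tb` is to be `k + 1` if `n` codes a predicate symbol of arity `k`. -/
def isFm (tb vm x : ℕ) : Bool :=
  exLt (2 ^ (x + 1)) fun S => S.testBit x && allLt (x + 1) fun y => imp (S.testBit y)
    ((y.unpair.1 == 0 && (entry tb y.unpair.2.unpair.1 == argLen y.unpair.2 + 1 &&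
        allLt (argLen y.unpair.2) fun j => isTm vm (argAt y.unpair.2 j))) ||
     ((y.unpair.1 == 1 || y.unpair.1 == 3) && S.testBit y.unpair.2) ||
     (y.unpair.1 == 2 && (S.testBit y.unpair.2.unpair.1 && S.testBit y.unpair.2.unpair.2)) ||
     (y.unpair.1 == 4 && (isSet vm y.unpair.2.unpair.1 && S.testBit y.unpair.2.unpair.2)) ||
     (y.unpair.1 == 5 && (isSet vm y.unpair.2.unpair.1 && isTm vm y.unpair.2.unpair.2)))

namespace PrimFun

variable {α : Type*} [Primcodable α] {f g h : α → ℕ}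

@[fun_prop]
theorem has (hf : PrimFun f) (hg : PrimFun g) (hh : PrimFun h) :
    PrimFun fun a => has (f a) (g a) (h a) := by unfold DFD.has; fun_prop

@[fun_prop]
theorem argLen (hf : PrimFun f) : PrimFun fun a => argLen (f a) := by
  unfold DFD.argLen; fun_prop

@[fun_prop]
theorem argAt (hf : PrimFun f) (hg : PrimFun g) : PrimFun fun a => argAt (f a) (g a) := by
  unfold DFD.argAt; fun_prop

@[fun_prop]
theorem unshift (hf : PrimFun f) : PrimFun fun a => unshift (f a) := by
  unfold DFD.unshift
  have := encodeList (map (f := fun a => Denumerable.ofNat (List ℕ) (f a).unpair.2)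
    (g := fun y => y.unpair.2) (by fun_prop) (by fun_prop))
  fun_prop

@[fun_prop]
theorem entry (hf : PrimFun f) (hg : PrimFun g) : PrimFun fun a => entry (f a) (g a) := by
  unfold DFD.entry; fun_prop

@[fun_prop]
theorem isTm (hf : PrimFun f) (hg : PrimFun g) : PrimFun fun a => isTm (f a) (g a) := by
  unfold DFD.isTm; fun_prop

@[fun_prop]
theorem isSet (hf : PrimFun f) (hg : PrimFun g) : PrimFun fun a => isSet (f a) (g a) := by
  unfold DFD.isSet; fun_prop

@[fun_prop]
theorem isFm (hf : PrimFun f) (hg : PrimFun g) (hh : PrimFun h) :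
    PrimFun fun a => isFm (f a) (g a) (h a) := by unfold DFD.isFm; fun_prop

end PrimFun

theorem exists_testBit_iff (n : ℕ) (p : ℕ → Prop) :
    ∃ S < 2 ^ n, ∀ y, S.testBit y = true ↔ y < n ∧ p y := by
  classical
  refine ⟨Nat.ofBits fun i : Fin n => decide (p i), Nat.ofBits_lt_two_pow _, fun y => ?_⟩
  rw [Nat.testBit_ofBits]
  split_ifs with h <;> simp [h]

theorem lt_of_testBit {S y : ℕ} (h : S.testBit y = true) : y < S :=
  lt_of_lt_of_le Nat.lt_two_pow_self (Nat.ge_two_pow_of_testBit h)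

theorem lt_of_has {i x S : ℕ} (h : has i x S = true) : Nat.pair i x < S := lt_of_testBit h

theorem right_lt_pair {a b : ℕ} (ha : 0 < a) : b < Nat.pair a b := by
  unfold Nat.pair
  split_ifs <;> nlinarith

section Codes

variable {V : Type u} [Encodable V]

theorem testBit_setCode (X : Finset (Term V)) (y : ℕ) :
    (setCode X).testBit y = true ↔ ∃ x ∈ X, x.code = y := by
  have : setCode X = ∑ i ∈ X.map ⟨Term.code, Term.code_injective⟩, 2 ^ i := by simp [setCode]
  rw [← Nat.mem_bitIndices, ← List.mem_toFinset, this, Finset.toFinset_bitIndices_sum_two_pow]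
  simp

theorem testBit_setCode_code (X : Finset (Term V)) (x : Term V) :
    (setCode X).testBit x.code = true ↔ x ∈ X := by
  simp [testBit_setCode, Term.code_injective.eq_iff]

theorem exists_setCode {X : ℕ} (hX : ∀ z, X.testBit z = true → ∃ t : Term V, t.code = z) :
    ∃ Y : Finset (Term V), setCode Y = X := by
  classical
  have hfin : {t : Term V | X.testBit t.code = true}.Finite :=
    Set.Finite.preimage Term.code_injective.injOn
      ((Set.finite_lt_nat X).subset fun z hz => lt_of_testBit hz)
  refine ⟨hfin.toFinset, Nat.eq_of_testBit_eq fun z => ?_⟩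
  rw [Bool.eq_iff_iff, testBit_setCode]
  constructor
  · rintro ⟨t, ht, rfl⟩
    simpa using ht
  · intro hz
    obtain ⟨t, rfl⟩ := hX z hz
    exact ⟨t, by simpa using hz, rfl⟩

theorem setCode_ne_zero {X : Finset (Term V)} : setCode X ≠ 0 ↔ X.Nonempty := by
  rw [Finset.nonempty_iff_ne_empty, not_iff_not]
  exact ⟨fun h => setCode_injective (by rw [h]; simp [setCode]), fun h => by simp [h, setCode]⟩

theorem Term.code_next (x : Term V) : x.next.code = Nat.pair 1 x.code := rfl

theorem code_iterate_next (k : ℕ) (x : Term V) :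
    (Term.next^[k] x).code = (Nat.pair 1)^[k] x.code := by
  induction k with
  | zero => rfl
  | succ k ih => rw [Function.iterate_succ_apply', Function.iterate_succ_apply', Term.code_next, ih]

variable (V) in
/-- The set of codes of variables. -/
noncomputable def varMask [Finite V] : ℕ :=
  setCode ((Set.finite_range (Term.var : V → Term V)).toFinset)

theorem testBit_varMask [Finite V] (y : ℕ) :
    (varMask V).testBit y = true ↔ ∃ v : V, (Term.var v).code = y := by
  simp [varMask, testBit_setCode]

/-- The witness set `S` replaces recursion on codes: it contains `x` and is closed under passing to
immediate components, which have smaller codes, so strong induction decodes all its elements.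
Conversely, the codes of all terms up to `x` form such a set. -/
theorem isTm_iff [Finite V] (x : ℕ) : isTm (varMask V) x = true ↔ ∃ t : Term V, t.code = x := by
  simp only [isTm, exLt_iff, allLt_iff, imp_iff, Bool.and_eq_true, Bool.or_eq_true, beq_iff_eq]
  constructor
  · rintro ⟨S, -, hx, hS⟩
    have key : ∀ y ≤ x, S.testBit y = true → ∃ t : Term V, t.code = y := by
      intro y
      induction y using Nat.strong_induction_on with
      | _ y ih =>
      intro hy hb
      rcases hS y (by omega) hb with h | ⟨h1, h2⟩
      · obtain ⟨v, hv⟩ := (testBit_varMask y).1 h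
        exact ⟨_, hv⟩
      · have h3 : Nat.pair 1 y.unpair.2 = y := by rw [← h1, Nat.pair_unpair]
        have h4 := right_lt_pair (a := 1) (b := y.unpair.2) one_pos
        rw [h3] at h4
        obtain ⟨t, ht⟩ := ih _ h4 (by omega) h2
        exact ⟨t.next, by rw [Term.code_next, ht, h3]⟩
    exact key x le_rfl hx
  · rintro ⟨t, rfl⟩
    obtain ⟨S, hS1, hS2⟩ := exists_testBit_iff (t.code + 1) fun y => ∃ t' : Term V, t'.code = y
    refine ⟨S, hS1, (hS2 _).2 ⟨by omega, t, rfl⟩, fun y hy hb => ?_⟩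
    obtain ⟨-, t', rfl⟩ := (hS2 _).1 hb
    cases t' with
    | var v => exact Or.inl ((testBit_varMask _).2 ⟨v, rfl⟩)
    | next t' =>
      refine Or.inr ⟨by simp [Term.code], (hS2 _).2 ⟨?_, t', by simp [Term.code]⟩⟩
      have := right_lt_pair (a := 1) (b := t'.code) one_pos
      simp only [Term.code, Nat.unpair_pair] at hy ⊢
      omega

theorem isSet_iff [Finite V] (X : ℕ) :
    isSet (varMask V) X = true ↔ ∃ Y : Finset (Term V), Y.Nonempty ∧ setCode Y = X := by
  simp only [isSet, allLt_iff, imp_iff, Bool.and_eq_true, isTm_iff, Bool.not_eq_true', beq_eq_false_iff_ne]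
  constructor
  · rintro ⟨h1, h2⟩
    obtain ⟨Y, rfl⟩ := exists_setCode (V := V) fun z hz => h2 z (lt_of_testBit hz) hz
    exact ⟨Y, setCode_ne_zero.1 h1, rfl⟩
  · rintro ⟨Y, hY, rfl⟩
    refine ⟨setCode_ne_zero.2 hY, fun z _ hz => ?_⟩
    obtain ⟨t, -, rfl⟩ := (testBit_setCode _ _).1 hz
    exact ⟨t, rfl⟩

variable {Pred : Type v} [Encodable Pred] {ar : Pred → ℕ}

theorem argLen_code (P : Pred) (x : Fin (ar P) → Term V) :
    argLen (Nat.pair (Encodable.encode P) (Encodable.encode (List.ofFn fun i => (x i).code))) =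
      ar P := by
  simp [argLen]

theorem argAt_code (P : Pred) (x : Fin (ar P) → Term V) (j : Fin (ar P)) :
    argAt (Nat.pair (Encodable.encode P) (Encodable.encode (List.ofFn fun i => (x i).code))) j =
      (x j).code := by
  simp [argAt]

theorem unshift_code (P : Pred) (x : Fin (ar P) → Term V) :
    unshift (Nat.pair (Encodable.encode P)
      (Encodable.encode (List.ofFn fun i => (x i).next.code))) =
      (Formula.atom P x : Formula V ar).code := by
  simp [unshift, Formula.code, List.map_ofFn, Function.comp_def, Term.code]

/-- The list coded by `tb` correctly gives arities, for predicate symbols with codes `≤ c`. -/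
def IsTable (ar : Pred → ℕ) (c tb : ℕ) : Prop :=
  (∀ n k, entry tb n = k + 1 → ∃ P : Pred, Encodable.encode P = n ∧ ar P = k) ∧
    ∀ P : Pred, Encodable.encode P ≤ c → entry tb (Encodable.encode P) = ar P + 1

/-- As for terms, the induction runs over the elements of a component-closed witness set. Components
are strictly smaller because every connective has a nonzero tag; atoms, with tag 0, are decoded
directly using the arity table. -/
theorem exists_of_isFm [Finite V] {c tb : ℕ} (htb : IsTable ar c tb) {x : ℕ}
    (hx : isFm tb (varMask V) x = true) : ∃ φ : Formula V ar, φ.EmptyFree ∧ φ.code = x := by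
  simp only [isFm, exLt_iff, allLt_iff, imp_iff, Bool.and_eq_true, Bool.or_eq_true, beq_iff_eq,
    isTm_iff, isSet_iff] at hx
  obtain ⟨S, -, hx, hS⟩ := hx
  suffices key : ∀ y ≤ x, S.testBit y = true → ∃ φ : Formula V ar, φ.EmptyFree ∧ φ.code = y from
    key x le_rfl hx
  intro y
  induction y using Nat.strong_induction_on with
  | _ y ih =>
  intro hy hb
  have h := hS y (by omega) hb
  obtain ⟨a, r, rfl⟩ : ∃ a r, y = Nat.pair a r := ⟨_, _, (Nat.pair_unpair y).symm⟩
  obtain ⟨r1, r2, rfl⟩ : ∃ a b, r = Nat.pair a b := ⟨_, _, (Nat.pair_unpair r).symm⟩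
  simp only [Nat.unpair_pair] at h
  have hl := Nat.left_le_pair r1 r2
  have hr := Nat.right_le_pair r1 r2
  have hp := fun ha => right_lt_pair (a := a) (b := Nat.pair r1 r2) ha
  rcases h with (((⟨rfl, h1, h2⟩ | ⟨rfl | rfl, h1⟩) | ⟨rfl, h1, h2⟩) |
    ⟨rfl, ⟨Y, h1, h2⟩, h3⟩) | ⟨rfl, ⟨Y, h1, h2⟩, t, h3⟩
  · obtain ⟨P, rfl, hP⟩ := htb.1 _ _ h1
    choose t ht using h2
    refine ⟨.atom P fun j => t j (hP ▸ j.2), trivial, ?_⟩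
    simp only [Formula.code, Nat.pair_eq_pair, true_and]
    refine Eq.trans (congrArg _ ?_) (Denumerable.encode_ofNat (α := List ℕ) r2)
    apply List.ext_getElem
    · rw [List.length_ofFn, hP, argLen]; simp
    · intro n h3 h4
      rw [List.getElem_ofFn, ht, argAt]
      simp only [Nat.unpair_pair]
      rw [List.getD_eq_getElem _ _ h4]
  · obtain ⟨φ, h2, h3⟩ := ih _ (hp one_pos) (by have := hp one_pos; omega) h1
    exact ⟨.neg φ, h2, by rw [Formula.code, h3]⟩
  · obtain ⟨φ, h2, h3⟩ := ih _ (hp (by omega)) (by have := hp (by omega); omega) h1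
    exact ⟨.next φ, h2, by rw [Formula.code, h3]⟩
  · have := hp (by omega)
    obtain ⟨φ, h3, h4⟩ := ih r1 (by omega) (by omega) h1
    obtain ⟨ψ, h5, h6⟩ := ih r2 (by omega) (by omega) h2
    exact ⟨.and φ ψ, ⟨h3, h5⟩, by rw [Formula.code, h4, h6]⟩
  · have := hp (by omega)
    obtain ⟨φ, h5, h6⟩ := ih r2 (by omega) (by omega) h3
    exact ⟨.quant Y φ, ⟨h1, h5⟩, by rw [Formula.code, h2, h6]⟩
  · exact ⟨.dep Y t, h1, by rw [Formula.code, h2, h3]⟩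

/-- All predicate symbols in a formula have codes `≤ c`. -/
def Formula.PredsLe (c : ℕ) : Formula V ar → Prop
  | .atom P _ => Encodable.encode P ≤ c
  | .neg φ => φ.PredsLe c
  | .and φ ψ => φ.PredsLe c ∧ ψ.PredsLe c
  | .next φ => φ.PredsLe c
  | .quant _ φ => φ.PredsLe c
  | .dep _ _ => True

theorem Formula.predsLe_of_code_le (φ : Formula V ar) {c : ℕ} (h : φ.code ≤ c) : φ.PredsLe c := by
  induction φ with
  | atom P x =>
    have h1 := Nat.right_le_pair 0 (Nat.pair (Encodable.encode P)
      (Encodable.encode (List.ofFn fun i => (x i).code)))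
    have h2 := Nat.left_le_pair (Encodable.encode P)
      (Encodable.encode (List.ofFn fun i => (x i).code))
    simp only [Formula.code] at h
    simp only [Formula.PredsLe]
    omega
  | neg φ ih => exact ih ((Nat.right_le_pair _ _).trans h)
  | and φ ψ ih₁ ih₂ =>
    exact ⟨ih₁ ((Nat.left_le_pair _ _).trans ((Nat.right_le_pair _ _).trans h)),
      ih₂ ((Nat.right_le_pair _ _).trans ((Nat.right_le_pair _ _).trans h))⟩
  | next φ ih => exact ih ((Nat.right_le_pair _ _).trans h)
  | quant X φ ih => exact ih ((Nat.right_le_pair _ _).trans ((Nat.right_le_pair _ _).trans h))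
  | dep X y => trivial

theorem isFm_code [Finite V] {c tb : ℕ} (htb : IsTable ar c tb) (φ : Formula V ar)
    (hc : φ.PredsLe c) (hφ : φ.EmptyFree) : isFm tb (varMask V) φ.code = true := by
  simp only [isFm, exLt_iff, allLt_iff, imp_iff, Bool.and_eq_true, Bool.or_eq_true, beq_iff_eq,
    isTm_iff, isSet_iff]
  obtain ⟨S, hS1, hS2⟩ := exists_testBit_iff (φ.code + 1)
    fun y => ∃ ψ : Formula V ar, ψ.PredsLe c ∧ ψ.EmptyFree ∧ ψ.code = y
  refine ⟨S, hS1, (hS2 _).2 ⟨by omega, φ, hc, hφ, rfl⟩, fun y hy hb => ?_⟩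
  obtain ⟨-, ψ, h1, h2, rfl⟩ := (hS2 _).1 hb
  cases ψ with
  | atom P x =>
    refine Or.inl (Or.inl (Or.inl (Or.inl ⟨by simp [Formula.code], ?_, ?_⟩)))
    · simp only [Formula.code, Nat.unpair_pair, argLen_code]
      exact htb.2 P h1
    · intro j hj
      simp only [Formula.code, Nat.unpair_pair, argLen_code] at hj ⊢
      exact ⟨x ⟨j, hj⟩, (argAt_code P x ⟨j, hj⟩).symm⟩
  | neg φ =>
    refine Or.inl (Or.inl (Or.inl (Or.inr ⟨Or.inl (by simp [Formula.code]), ?_⟩)))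
    have := Nat.right_le_pair 1 φ.code
    simp only [Formula.code, Nat.unpair_pair] at hy ⊢
    exact (hS2 _).2 ⟨by omega, φ, h1, h2, rfl⟩
  | and φ ψ =>
    refine Or.inl (Or.inl (Or.inr ⟨by simp [Formula.code], ?_⟩))
    have h3 := Nat.right_le_pair 2 (Nat.pair φ.code ψ.code)
    have h4 := Nat.right_le_pair φ.code ψ.code
    have h5 := Nat.left_le_pair φ.code ψ.code
    simp only [Formula.code, Nat.unpair_pair] at hy ⊢
    exact ⟨(hS2 _).2 ⟨by omega, φ, h1.1, h2.1, rfl⟩, (hS2 _).2 ⟨by omega, ψ, h1.2, h2.2, rfl⟩⟩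
  | next φ =>
    refine Or.inl (Or.inl (Or.inl (Or.inr ⟨Or.inr (by simp [Formula.code]), ?_⟩)))
    have := Nat.right_le_pair 3 φ.code
    simp only [Formula.code, Nat.unpair_pair] at hy ⊢
    exact (hS2 _).2 ⟨by omega, φ, h1, h2, rfl⟩
  | quant X φ =>
    refine Or.inl (Or.inr ⟨by simp [Formula.code], ?_⟩)
    have h3 := Nat.right_le_pair 4 (Nat.pair (setCode X) φ.code)
    have h4 := Nat.right_le_pair (setCode X) φ.code
    simp only [Formula.code, Nat.unpair_pair] at hy ⊢
    exact ⟨⟨X, h2.1, rfl⟩, (hS2 _).2 ⟨by omega, φ, h1, h2.2, rfl⟩⟩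
  | dep X y =>
    refine Or.inr ⟨by simp [Formula.code], ?_⟩
    simp only [Formula.code, Nat.unpair_pair]
    exact ⟨⟨X, h2, rfl⟩, y, rfl⟩

end Codes

/-! ### Primitive recursive tests for closed families and quasimodels -/

/-- Universal quantification over the elements of the set coded by `X`. -/
def allIn (X : ℕ) (f : ℕ → Bool) : Bool := allLt X fun z => imp (X.testBit z) (f z)

/-- Universal quantification over the `x` such that `(i, x)` is in the set coded by `S`. -/
def allAt (i S : ℕ) (f : ℕ → Bool) : Bool :=
  allLt S fun p => imp (S.testBit p && p.unpair.1 == i) (f p.unpair.2)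

/-- Existential quantification over the `x` such that `(i, x)` is in the set coded by `S`. -/
def exAt (i S : ℕ) (f : ℕ → Bool) : Bool :=
  exLt S fun p => (S.testBit p && p.unpair.1 == i) && f p.unpair.2

@[simp] theorem allIn_iff {X : ℕ} {f : ℕ → Bool} :
    allIn X f = true ↔ ∀ z, X.testBit z = true → f z = true := by
  simp only [allIn, allLt_iff, imp_iff]
  exact ⟨fun h z hz => h z (lt_of_testBit hz) hz, fun h z _ hz => h z hz⟩

@[simp] theorem allAt_iff {i S : ℕ} {f : ℕ → Bool} :
    allAt i S f = true ↔ ∀ x, has i x S = true → f x = true := by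
  simp only [allAt, allLt_iff, imp_iff, Bool.and_eq_true, beq_iff_eq]
  constructor
  · intro h x hx
    simpa using h _ (lt_of_has hx) ⟨hx, by simp⟩
  · rintro h p - ⟨hp, rfl⟩
    exact h _ (by rwa [has, Nat.pair_unpair])

@[simp] theorem exAt_iff {i S : ℕ} {f : ℕ → Bool} :
    exAt i S f = true ↔ ∃ x, has i x S = true ∧ f x = true := by
  simp only [exAt, exLt_iff, Bool.and_eq_true, beq_iff_eq]
  constructor
  · rintro ⟨p, -, ⟨hp, rfl⟩, h⟩
    exact ⟨_, by rwa [has, Nat.pair_unpair], h⟩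
  · rintro ⟨x, hx, h⟩
    exact ⟨_, lt_of_has hx, ⟨hx, by simp⟩, by simpa using h⟩

/-- The set coded by `X` consists of elements of the `i`-th set coded by `T`. -/
def subAt (i X T : ℕ) : Bool := allIn X fun z => has i z T

/-- Closure of the family of sets of formulas coded by `F` at its member `x` at time `i`; the terms
allowed at time `i` are coded by `T`. -/
def closedAt (tb vm N T F i x : ℕ) : Bool :=
  i.ble N && (isFm tb vm x &&
  (imp (x.unpair.1 == 0) ((allLt (argLen x.unpair.2) fun j => has i (argAt x.unpair.2 j) T) &&
    imp (!(argLen x.unpair.2 == 0) &&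
      allLt (argLen x.unpair.2) fun j => (argAt x.unpair.2 j).unpair.1 == 1)
      (has (i + 1) (unshift x.unpair.2) F)) &&
  (imp (x.unpair.1 == 1) (has i x.unpair.2 F) &&
  (imp (x.unpair.1 == 2) (has i x.unpair.2.unpair.1 F && has i x.unpair.2.unpair.2 F) &&
  (imp (x.unpair.1 == 3) (has (i + 1) x.unpair.2 F) &&
  (imp (x.unpair.1 == 4) (subAt i x.unpair.2.unpair.1 T && has i x.unpair.2.unpair.2 F) &&
  (imp (x.unpair.1 == 5) (subAt i x.unpair.2.unpair.1 T && has i x.unpair.2.unpair.2 T) &&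
  imp (Nat.ble 1 i) (has (i - 1) (Nat.pair 3 x) F))))))))

/-- `T` codes the sets of terms denoting values at times up to `N`. -/
def termsOk (vm N T : ℕ) : Bool :=
  (allIn T fun p => p.unpair.1.ble N && ((vm.testBit p.unpair.2 ||
    (p.unpair.2.unpair.1 == 1 && has (p.unpair.1 + 1) p.unpair.2.unpair.2 T)) &&
    imp (Nat.ble 1 p.unpair.1) (has (p.unpair.1 - 1) (Nat.pair 1 p.unpair.2) T))) &&
  allLt (N + 1) fun i => subAt i vm T

/-- The family of sets of formulas coded by `F` is closed and `c` belongs to its first set. -/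
def isClosed (tb vm c N T F : ℕ) : Bool :=
  has 0 c F && (termsOk vm N T && ((allIn F fun p =>
    closedAt tb vm N T F p.unpair.1 p.unpair.2) &&
  allLt (N + 1) fun i => allLt (2 ^ T) fun X => allAt i T fun y =>
    imp (!(X == 0) && subAt i X T) (has i (Nat.pair 5 (Nat.pair X y)) F)))

/-- The formula `y` is determined by the terms `z` such that the type `τ` says that `○^k z` depends
on `X`. -/
def isDetNow (τ X k y : ℕ) : Bool :=
  (y.unpair.1 == 0 && allLt (argLen y.unpair.2) fun j =>
    τ.testBit (Nat.pair 5 (Nat.pair X ((Nat.pair 1)^[k] (argAt y.unpair.2 j))))) ||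
  ((y.unpair.1 == 4 || y.unpair.1 == 5) && allIn y.unpair.2.unpair.1 fun z =>
    τ.testBit (Nat.pair 5 (Nat.pair X ((Nat.pair 1)^[k] z))))

/-- The formula `x` is determined by the terms which the type `τ` says depend on `X`. -/
def isDet (N τ X x : ℕ) : Bool :=
  exLt (N + 1) fun k => exLt (x + 1) fun y => (Nat.pair 3)^[k] y == x && isDetNow τ X k y

/-- The conditions on a type `τ` in a quasimodel `Q`, at an atom `x`. -/
def atomOk (F Q τ x : ℕ) : Bool :=
  imp (!(argLen x.unpair.2 == 0) &&
      allLt (argLen x.unpair.2) fun j => (argAt x.unpair.2 j).unpair.1 == 1)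
    (biff (τ.testBit x) (τ.testBit (Nat.pair 3 (unshift x.unpair.2)))) &&
  imp (argLen x.unpair.2 == 0) (allIn Q fun q => imp (has q.unpair.1 x F)
    (biff (τ.testBit x) (q.unpair.2.testBit x)))

/-- The conditions on a type `τ` at time `i` in a quasimodel `Q`, at a quantified formula `x`. -/
def quantOk (N F Q i τ x : ℕ) : Bool :=
  imp (τ.testBit x) (τ.testBit x.unpair.2.unpair.2) &&
  imp (!τ.testBit x) (exAt i Q fun b => !b.testBit x.unpair.2.unpair.2 && allAt i F fun z =>
    imp (isDet N τ x.unpair.2.unpair.1 z) (biff (τ.testBit z) (b.testBit z)))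

/-- The conditions on a type `τ` at time `i` in a quasimodel, at a dependence atom `x`. -/
def depOk (vm F i τ x : ℕ) : Bool :=
  imp (x.unpair.2.unpair.1.testBit x.unpair.2.unpair.2) (τ.testBit x) &&
  (imp (allIn vm fun y => x.unpair.2.unpair.1.testBit y) (τ.testBit x) &&
  ((allAt i F fun z => imp (z.unpair.1 == 5 && (z.unpair.2.unpair.2 == x.unpair.2.unpair.2 &&
    (τ.testBit z && allIn z.unpair.2.unpair.1 fun y =>
      τ.testBit (Nat.pair 5 (Nat.pair x.unpair.2.unpair.1 y))))) (τ.testBit x)) &&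
  imp (x.unpair.2.unpair.2.unpair.1 == 1) (allAt (i + 1) F fun z =>
    imp (z.unpair.1 == 5 && (z.unpair.2.unpair.2 == x.unpair.2.unpair.2.unpair.2 &&
    (τ.testBit (Nat.pair 3 z) && allIn z.unpair.2.unpair.1 fun y =>
      x.unpair.2.unpair.1.testBit (Nat.pair 1 y)))) (τ.testBit x))))

/-- The conditions on a type `τ` at time `i` in a quasimodel `Q`, at a formula `x`. -/
def formulaOk (vm N F Q i τ x : ℕ) : Bool :=
  imp (x.unpair.1 == 0) (atomOk F Q τ x) &&
  (imp (x.unpair.1 == 1) (biff (τ.testBit x) (!τ.testBit x.unpair.2)) &&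
  (imp (x.unpair.1 == 2) (biff (τ.testBit x)
    (τ.testBit x.unpair.2.unpair.1 && τ.testBit x.unpair.2.unpair.2)) &&
  (imp (x.unpair.1 == 4) (quantOk N F Q i τ x) &&
  imp (x.unpair.1 == 5) (depOk vm F i τ x))))

/-- The conditions on a type `τ` at time `i` in a quasimodel `Q`. -/
def typeOk (vm N F Q i τ : ℕ) : Bool :=
  subAt i τ F && (imp ((i + 1).ble N) (exAt (i + 1) Q fun b => allAt (i + 1) F fun x =>
    biff (b.testBit x) (τ.testBit (Nat.pair 3 x))) &&
  allAt i F fun x => formulaOk vm N F Q i τ x)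

/-- `Q` codes a quasimodel over the family of sets of formulas coded by `F`. -/
def isQuasi (vm N F Q : ℕ) : Bool :=
  allIn Q fun q => typeOk vm N F Q q.unpair.1 q.unpair.2

/-- There is a quasimodel with a type refuting `c` at time `0`. -/
def refutable (vm c N F : ℕ) : Bool :=
  exLt (2 ^ Nat.pair (N + 1) (2 ^ F)) fun Q => isQuasi vm N F Q &&
    exAt 0 Q fun τ => !τ.testBit c

namespace PrimFun

variable {α : Type*} [Primcodable α] {f₁ f₂ f₃ f₄ f₅ f₆ f₇ : α → ℕ}

@[fun_prop]
theorem allIn {f : α → ℕ → Bool} (h₁ : PrimFun f₁) (hf : PrimFun (fun p : α × ℕ => f p.1 p.2)) :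
    PrimFun fun a => allIn (f₁ a) (fun x => f a x) := by
  unfold DFD.allIn; fun_prop

@[fun_prop]
theorem allAt {f : α → ℕ → Bool} (h₁ : PrimFun f₁) (h₂ : PrimFun f₂)
    (hf : PrimFun (fun p : α × ℕ => f p.1 p.2)) :
    PrimFun fun a => allAt (f₁ a) (f₂ a) (fun x => f a x) := by
  have h := hf.comp (g := fun p : α × ℕ => (p.1, p.2.unpair.2)) (by fun_prop)
  unfold DFD.allAt; fun_prop

@[fun_prop]
theorem exAt {f : α → ℕ → Bool} (h₁ : PrimFun f₁) (h₂ : PrimFun f₂)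
    (hf : PrimFun (fun p : α × ℕ => f p.1 p.2)) :
    PrimFun fun a => exAt (f₁ a) (f₂ a) (fun x => f a x) := by
  have h := hf.comp (g := fun p : α × ℕ => (p.1, p.2.unpair.2)) (by fun_prop)
  unfold DFD.exAt; fun_prop

@[fun_prop]
theorem subAt (h₁ : PrimFun f₁) (h₂ : PrimFun f₂) (h₃ : PrimFun f₃) :
    PrimFun fun a => subAt (f₁ a) (f₂ a) (f₃ a) := by unfold DFD.subAt; fun_prop

@[fun_prop]
theorem closedAt (h₁ : PrimFun f₁) (h₂ : PrimFun f₂) (h₃ : PrimFun f₃) (h₄ : PrimFun f₄)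
    (h₅ : PrimFun f₅) (h₆ : PrimFun f₆) (h₇ : PrimFun f₇) :
    PrimFun fun a => closedAt (f₁ a) (f₂ a) (f₃ a) (f₄ a) (f₅ a) (f₆ a) (f₇ a) := by
  unfold DFD.closedAt; fun_prop

@[fun_prop]
theorem termsOk (h₁ : PrimFun f₁) (h₂ : PrimFun f₂) (h₃ : PrimFun f₃) :
    PrimFun fun a => termsOk (f₁ a) (f₂ a) (f₃ a) := by unfold DFD.termsOk; fun_prop

@[fun_prop]
theorem isClosed (h₁ : PrimFun f₁) (h₂ : PrimFun f₂) (h₃ : PrimFun f₃) (h₄ : PrimFun f₄)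
    (h₅ : PrimFun f₅) (h₆ : PrimFun f₆) :
    PrimFun fun a => isClosed (f₁ a) (f₂ a) (f₃ a) (f₄ a) (f₅ a) (f₆ a) := by
  unfold DFD.isClosed; fun_prop

@[fun_prop]
theorem isDetNow (h₁ : PrimFun f₁) (h₂ : PrimFun f₂) (h₃ : PrimFun f₃) (h₄ : PrimFun f₄) :
    PrimFun fun a => isDetNow (f₁ a) (f₂ a) (f₃ a) (f₄ a) := by unfold DFD.isDetNow; fun_prop

@[fun_prop]
theorem isDet (h₁ : PrimFun f₁) (h₂ : PrimFun f₂) (h₃ : PrimFun f₃) (h₄ : PrimFun f₄) :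
    PrimFun fun a => isDet (f₁ a) (f₂ a) (f₃ a) (f₄ a) := by unfold DFD.isDet; fun_prop

@[fun_prop]
theorem atomOk (h₁ : PrimFun f₁) (h₂ : PrimFun f₂) (h₃ : PrimFun f₃) (h₄ : PrimFun f₄) :
    PrimFun fun a => atomOk (f₁ a) (f₂ a) (f₃ a) (f₄ a) := by
  unfold DFD.atomOk; fun_prop

@[fun_prop]
theorem quantOk (h₁ : PrimFun f₁) (h₂ : PrimFun f₂) (h₃ : PrimFun f₃) (h₄ : PrimFun f₄)
    (h₅ : PrimFun f₅) (h₆ : PrimFun f₆) :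
    PrimFun fun a => quantOk (f₁ a) (f₂ a) (f₃ a) (f₄ a) (f₅ a) (f₆ a) := by
  unfold DFD.quantOk; fun_prop

@[fun_prop]
theorem depOk (h₁ : PrimFun f₁) (h₂ : PrimFun f₂) (h₃ : PrimFun f₃) (h₄ : PrimFun f₄)
    (h₅ : PrimFun f₅) : PrimFun fun a => depOk (f₁ a) (f₂ a) (f₃ a) (f₄ a) (f₅ a) := by
  unfold DFD.depOk; fun_prop

@[fun_prop]
theorem formulaOk (h₁ : PrimFun f₁) (h₂ : PrimFun f₂) (h₃ : PrimFun f₃) (h₄ : PrimFun f₄)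
    (h₅ : PrimFun f₅) (h₆ : PrimFun f₆) (h₇ : PrimFun f₇) :
    PrimFun fun a => formulaOk (f₁ a) (f₂ a) (f₃ a) (f₄ a) (f₅ a) (f₆ a) (f₇ a) := by
  unfold DFD.formulaOk; fun_prop

@[fun_prop]
theorem typeOk (h₁ : PrimFun f₁) (h₂ : PrimFun f₂) (h₃ : PrimFun f₃) (h₄ : PrimFun f₄)
    (h₅ : PrimFun f₅) (h₆ : PrimFun f₆) :
    PrimFun fun a => typeOk (f₁ a) (f₂ a) (f₃ a) (f₄ a) (f₅ a) (f₆ a) := by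
  unfold DFD.typeOk; fun_prop

@[fun_prop]
theorem isQuasi (h₁ : PrimFun f₁) (h₂ : PrimFun f₂) (h₃ : PrimFun f₃) (h₄ : PrimFun f₄) :
    PrimFun fun a => isQuasi (f₁ a) (f₂ a) (f₃ a) (f₄ a) := by unfold DFD.isQuasi; fun_prop

@[fun_prop]
theorem refutable (h₁ : PrimFun f₁) (h₂ : PrimFun f₂) (h₃ : PrimFun f₃) (h₄ : PrimFun f₄) :
    PrimFun fun a => refutable (f₁ a) (f₂ a) (f₃ a) (f₄ a) := by unfold DFD.refutable; fun_prop

end PrimFun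

theorem boole_ble {a b : ℕ} : a.ble b = true ↔ a ≤ b := by
  rw [Nat.ble_eq]

/-! ### Correctness of the tests -/

section

variable {V : Type u} [Encodable V] [Finite V]

theorem subAt_iff {i X T : ℕ} :
    subAt i X T = true ↔ ∀ z, X.testBit z = true → has i z T = true := by
  simp only [subAt, allIn_iff]

theorem subAt_setCode {i T : ℕ} {X : Finset (Term V)} :
    subAt i (setCode X) T = true ↔ ∀ x ∈ X, has i x.code T = true := by
  simp only [subAt_iff, testBit_setCode]
  exact ⟨fun h x hx => h _ ⟨x, hx, rfl⟩, fun h z ⟨x, hx, hz⟩ => hz ▸ h x hx⟩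

/-- Membership of `○t` at time `i` is tied, in both directions, to that of `t` at time `i + 1`, and
all variables are present up to time `N`. Induction on the term then pins the set down. -/
theorem has_of_termsOk {N T : ℕ} (h : termsOk (varMask V) N T = true) (i : ℕ) (t : Term V) :
    has i t.code T = true ↔ i + t.depth ≤ N := by
  simp only [termsOk, Bool.and_eq_true, allIn_iff, allLt_iff, imp_iff, Bool.or_eq_true, beq_iff_eq,
    boole_ble, subAt_iff, testBit_varMask] at h
  obtain ⟨h1, h2⟩ := h
  have h3 := fun i x (hx : has i x T = true) => h1 _ hx
  simp only [Nat.unpair_pair] at h3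
  induction t generalizing i with
  | var v =>
    refine ⟨fun h4 => (h3 _ _ h4).1, fun h4 => h2 i ?_ _ ⟨v, rfl⟩⟩
    simp only [Term.depth] at h4; omega
  | next t ih =>
    constructor
    · intro h4
      obtain ⟨-, h5 | ⟨-, h5⟩, -⟩ := h3 _ _ h4
      · obtain ⟨v, hv⟩ := h5
        exact absurd (Term.code_injective hv) (by simp)
      · simp only [Term.code, Nat.unpair_pair] at h5
        have := (ih _).1 h5
        simp only [Term.depth]; omega
    · intro h4
      simp only [Term.depth] at h4
      exact (h3 _ _ ((ih (i + 1)).2 (by omega))).2.2 (by omega)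

variable {Pred : Type v} [Encodable Pred] {ar : Pred → ℕ} {c tb N T F : ℕ}

theorem exists_formula_of_isClosed (htb : IsTable ar c tb)
    (h : isClosed tb (varMask V) c N T F = true) {i x : ℕ} (hx : has i x F = true) :
    ∃ φ : Formula V ar, φ.EmptyFree ∧ φ.code = x := by
  simp only [isClosed, Bool.and_eq_true, allIn_iff] at h
  have h1 := h.2.2.1 _ hx
  simp only [closedAt, Bool.and_eq_true, Nat.unpair_pair] at h1
  exact exists_of_isFm htb h1.2.1

theorem closure_of_isClosed (htb : IsTable ar c tb)
    (h : isClosed tb (varMask V) c N T F = true) :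
    Closure (fun i (φ : Formula V ar) => has i φ.code F = true) N := by
  have hef : ∀ {i} {φ : Formula V ar}, has i φ.code F = true → φ.EmptyFree := by
    intro i φ hφ
    obtain ⟨ψ, h1, h2⟩ := exists_formula_of_isClosed htb h hφ
    exact Formula.code_injective h2 ▸ h1
  simp only [isClosed, Bool.and_eq_true, allIn_iff, allAt_iff, allLt_iff, imp_iff,
    Bool.not_eq_true', beq_eq_false_iff_ne]
    at h
  obtain ⟨-, hT, hF, hD⟩ := h
  have hT' := has_of_termsOk hT
  have hF' := fun i x (hx : has i x F = true) => hF _ hx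
  simp only [closedAt, Bool.and_eq_true, allLt_iff, imp_iff, beq_iff_eq,
    boole_ble, Bool.not_eq_true', beq_eq_false_iff_ne, Nat.unpair_pair] at hF'
  refine ⟨?_, ?_, ?_, ?_, ?_, ?_, ?_, ?_⟩
  · exact fun h1 => (hF' _ _ h1).1
  · intro i P x h1 j
    have h2 := ((hF' _ _ h1).2.2.1 (by simp [Formula.code])).1
    simp only [Formula.code, Nat.unpair_pair, argLen_code] at h2
    have h3 := h2 j j.2
    rwa [argAt_code, hT'] at h3
  · intro i P x h1 hP
    have h2 := ((hF' _ _ h1).2.2.1 (by simp [Formula.code])).2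
    simp only [Formula.code, Nat.unpair_pair, argLen_code] at h2
    rw [unshift_code] at h2
    refine h2 ⟨hP.ne', fun j hj => ?_⟩
    have h3 := argAt_code P (fun j => (x j).next) ⟨j, hj⟩
    simp only at h3
    rw [h3]
    simp [Term.code]
  · intro i ψ h1
    have h2 := (hF' _ _ h1).2.2.2.1 (by simp [Formula.code])
    simpa only [Formula.code, Nat.unpair_pair] using h2
  · intro i ψ χ h1
    have h2 := (hF' _ _ h1).2.2.2.2.1 (by simp [Formula.code])
    simpa only [Formula.code, Nat.unpair_pair] using h2
  · intro i ψ
    constructor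
    · intro h1
      have h2 := (hF' _ _ h1).2.2.2.2.2.1 (by simp [Formula.code])
      simpa only [Formula.code, Nat.unpair_pair] using h2
    · intro h1
      exact (hF' _ _ h1).2.2.2.2.2.2.2.2 (by omega)
  · intro i X ψ h1
    have h2 := (hF' _ _ h1).2.2.2.2.2.2.1 (by simp [Formula.code])
    simp only [Formula.code, Nat.unpair_pair, subAt_setCode, hT'] at h2
    exact ⟨(hef h1).1, h2⟩
  · intro i X y
    constructor
    · intro h1
      have h2 := (hF' _ _ h1).2.2.2.2.2.2.2.1 (by simp [Formula.code])
      simp only [Formula.code, Nat.unpair_pair, subAt_setCode, hT'] at h2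
      exact ⟨hef h1, h2⟩
    · rintro ⟨h1, h2, h3⟩
      have h4 : has i y.code T = true := (hT' _ _).2 h3
      have h5 : subAt i (setCode X) T = true := subAt_setCode.2 fun x hx => (hT' _ _).2 (h2 x hx)
      refine hD i (by omega) (setCode X) ?_ y.code h4 ⟨setCode_ne_zero.2 h1, h5⟩
      -- Each `z` in the set satisfies `z ≤ Nat.pair i z < T`, so its code is below `2 ^ T`, within
      -- the range of the bounded quantifier.
      · refine Nat.lt_pow_two_of_testBit _ fun z hz => ?_
        by_contra h6
        have h7 := lt_of_has (subAt_iff.1 h5 z (by simpa using h6))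
        have := Nat.right_le_pair i z
        omega

theorem Formula.code_next (φ : Formula V ar) : φ.next.code = Nat.pair 3 φ.code := rfl

theorem Formula.code_dep (X : Finset (Term V)) (y : Term V) :
    (Formula.dep X y : Formula V ar).code = Nat.pair 5 (Nat.pair (setCode X) y.code) := rfl

theorem Formula.code_iterate_next (k : ℕ) (φ : Formula V ar) :
    (Formula.next^[k] φ).code = (Nat.pair 3)^[k] φ.code := by
  induction k with
  | zero => rfl
  | succ k ih =>
    rw [Function.iterate_succ_apply', Function.iterate_succ_apply', Formula.code_next, ih]

theorem le_iterate_pair (k x : ℕ) : x ≤ (Nat.pair 3)^[k] x := by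
  induction k with
  | zero => exact le_rfl
  | succ k ih =>
    rw [Function.iterate_succ_apply']
    exact ih.trans (Nat.right_le_pair _ _)

theorem Closure.iterate_next {F : ℕ → Formula V ar → Prop} (hF : Closure F N) {i k : ℕ}
    {φ : Formula V ar} : F i (Formula.next^[k] φ) ↔ F (i + k) φ := by
  induction k generalizing i with
  | zero => exact Iff.rfl
  | succ k ih =>
    rw [Function.iterate_succ_apply', hF.next, ih, show i + 1 + k = i + (k + 1) by omega]

theorem isDetNow_iff {τ : ℕ} {X : Finset (Term V)} {k : ℕ} {χ : Formula V ar} :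
    isDetNow τ (setCode X) k χ.code = true ↔ χ.DetNow fun y =>
      τ.testBit (Formula.dep X (Term.next^[k] y) : Formula V ar).code = true := by
  have key : ∀ Z : Finset (Term V), (∀ z, (setCode Z).testBit z = true →
      τ.testBit (Nat.pair 5 (Nat.pair (setCode X) ((Nat.pair 1)^[k] z))) = true) ↔
      ∀ z ∈ Z, τ.testBit (Nat.pair 5 (Nat.pair (setCode X) (Term.next^[k] z).code)) = true := by
    intro Z
    constructor
    · intro h z hz
      have hz' := (testBit_setCode_code Z z).2 hz
      rw [DFD.code_iterate_next]
      exact h _ hz'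
    · intro h z hz
      obtain ⟨t, ht, rfl⟩ := (testBit_setCode _ _).1 hz
      rw [← DFD.code_iterate_next]
      exact h t ht
  simp only [isDetNow, Bool.and_eq_true, allLt_iff, allIn_iff, Bool.or_eq_true, beq_iff_eq, Formula.code_dep]
  cases χ with
  | atom P x =>
    simp only [Formula.DetNow, Formula.code, Nat.unpair_pair, argLen_code]
    simp only [true_and, DFD.code_iterate_next]
    constructor
    · rintro (h | h)
      · intro j
        have := h j j.2
        rwa [argAt_code] at this
      · simp at h
    · intro h
      refine Or.inl fun j hj => ?_
      have := h ⟨j, hj⟩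
      rwa [← argAt_code P x ⟨j, hj⟩] at this
  | neg => simp [Formula.code, Formula.DetNow]
  | and => simp [Formula.code, Formula.DetNow]
  | next => simp [Formula.code, Formula.DetNow]
  | quant Z φ => simp [Formula.code, Formula.DetNow, key]
  | dep Z y => simp [Formula.code, Formula.DetNow, key]

/-- The search for `k` may stop at `N`: if `○^k χ` occurs at time `i`, then `χ` occurs at time `i +
k`, hence `i + k ≤ N`. The search for `χ` is bounded since prefixing `○` does not decrease codes. -/
theorem isDet_of_det {F : ℕ → Formula V ar → Prop} (hF : Closure F N) {i : ℕ} {τ : ℕ}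
    {X : Finset (Term V)} {ψ : Formula V ar} (hi : F i ψ)
    (hψ : ψ.Det fun y => τ.testBit (Formula.dep X y : Formula V ar).code = true) :
    isDet N τ (setCode X) ψ.code = true := by
  obtain ⟨k, χ, rfl, hχ⟩ := hψ
  rw [isDet, exLt_iff]
  have h1 := hF.le_of (hF.iterate_next.1 hi)
  refine ⟨k, by omega, ?_⟩
  rw [exLt_iff]
  have h2 := le_iterate_pair k χ.code
  rw [Formula.code_iterate_next]
  refine ⟨χ.code, by omega, ?_⟩
  rw [Bool.and_eq_true, isDetNow_iff]
  exact ⟨by simp, hχ⟩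

theorem exists_of_iterate_pair {k y : ℕ} {ψ : Formula V ar} (h : (Nat.pair 3)^[k] y = ψ.code) :
    ∃ χ : Formula V ar, ψ = Formula.next^[k] χ ∧ y = χ.code := by
  induction k generalizing ψ with
  | zero => exact ⟨ψ, rfl, h⟩
  | succ k ih =>
    rw [Function.iterate_succ_apply'] at h
    cases ψ <;> simp only [Formula.code, Nat.pair_eq_pair] at h <;> try omega
    obtain ⟨χ, rfl, h2⟩ := ih h.2
    exact ⟨χ, (Function.iterate_succ_apply' _ _ _).symm, h2⟩

theorem det_of_isDet {τ : ℕ} {X : Finset (Term V)} {ψ : Formula V ar}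
    (h : isDet N τ (setCode X) ψ.code = true) :
    ψ.Det fun y => τ.testBit (Formula.dep X y : Formula V ar).code = true := by
  rw [isDet, exLt_iff] at h
  obtain ⟨k, -, h⟩ := h
  rw [exLt_iff] at h
  obtain ⟨y, -, h⟩ := h
  rw [Bool.and_eq_true, beq_iff_eq] at h
  obtain ⟨χ, rfl, hy⟩ := exists_of_iterate_pair h.1
  subst hy
  exact ⟨k, χ, rfl, isDetNow_iff.1 h.2⟩

end

section

variable {V : Type u} [Encodable V] [Finite V] {Pred : Type v} [Encodable Pred] {ar : Pred → ℕ}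
  {c tb N T F : ℕ}

theorem quasiModel_of_isQuasi {Q : ℕ}
    (hF : Closure (fun i (φ : Formula V ar) => has i φ.code F = true) N)
    (hQ : isQuasi (varMask V) N F Q = true) :
    QuasiModel (fun i (φ : Formula V ar) => has i φ.code F = true) N
      (fun τ φ => τ.testBit φ.code = true) (fun i τ => has i τ Q = true) := by
  simp only [isQuasi, allIn_iff] at hQ
  have hQ' := fun i τ (hτ : has i τ Q = true) => hQ _ hτ
  simp only [Nat.unpair_pair, typeOk, formulaOk, Bool.and_eq_true, allAt_iff, exAt_iff, imp_iff,
    biff_iff, beq_iff_eq, boole_ble, subAt_iff] at hQ'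
  refine ⟨?_, ?_, ?_, ?_, ?_, ?_, ?_, ?_, ?_, ?_, ?_, ?_⟩
  · exact fun h1 h2 => (hQ' _ _ h1).1 _ h2
  · intro i a hi h1
    obtain ⟨b, h2, h3⟩ := (hQ' _ _ h1).2.1 hi
    exact ⟨b, h2, fun ψ hψ => h3 _ hψ⟩
  · intro i a P x h1 h2 h3
    have h4 := ((hQ' _ _ h1).2.2 _ h2).1 (by simp [Formula.code])
    simp only [atomOk, Bool.and_eq_true, imp_iff, allLt_iff, beq_iff_eq, biff_iff] at h4
    replace h4 := h4.1
    simp only [Formula.code, Nat.unpair_pair, argLen_code] at h4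
    rw [unshift_code] at h4
    refine h4 ⟨by simpa using h3.ne', fun j hj => ?_⟩
    have h5 := argAt_code P (fun j => (x j).next) ⟨j, hj⟩
    simp only at h5
    rw [h5]
    simp [Term.code]
  · intro i i' a b P x hP h1 h2 h3 h4
    have h5 := ((hQ' _ _ h1).2.2 _ h3).1 (by simp [Formula.code])
    simp only [atomOk, Bool.and_eq_true, imp_iff, allIn_iff, beq_iff_eq, biff_iff] at h5
    have h6 : argLen (Formula.atom P x : Formula V ar).code.unpair.2 = 0 := by
      rw [Formula.code, Nat.unpair_pair, argLen_code, hP]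
    replace h5 := h5.2 h6 _ h2
    simp only [Nat.unpair_pair] at h5
    exact h5 h4
  · intro i a ψ h1 h2
    have h3 := ((hQ' _ _ h1).2.2 _ h2).2.1 (by simp [Formula.code])
    simpa [Formula.code] using h3
  · intro i a ψ χ h1 h2
    have h3 := ((hQ' _ _ h1).2.2 _ h2).2.2.1 (by simp [Formula.code])
    simpa only [Formula.code, Nat.unpair_pair] using h3
  · intro i a X ψ h1 h2
    have h3 := ((hQ' _ _ h1).2.2 _ h2).2.2.2.1 (by simp [Formula.code])
    simp only [quantOk, Bool.and_eq_true, imp_iff] at h3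
    simpa only [Formula.code, Nat.unpair_pair] using h3.1
  · intro i a X ψ h1 h2 h3
    have h4 := ((hQ' _ _ h1).2.2 _ h2).2.2.2.1 (by simp [Formula.code])
    simp only [quantOk, Bool.and_eq_true, imp_iff, exAt_iff, allAt_iff, biff_iff] at h4
    obtain ⟨b, h5, h6, h7⟩ := h4.2 (by simpa using h3)
    simp only [Formula.code, Nat.unpair_pair] at h6 h7
    exact ⟨b, h5, by simpa using h6, fun χ hχ hd => h7 _ hχ (isDet_of_det hF hχ hd)⟩
  · intro i a X x h1 h2 h3
    have h4 := ((hQ' _ _ h1).2.2 _ h2).2.2.2.2 (by simp [Formula.code])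
    simp only [depOk, Bool.and_eq_true, imp_iff] at h4
    exact h4.1 (by simpa only [Formula.code, Nat.unpair_pair, testBit_setCode_code] using h3)
  · intro i a X Z y h1 h2 h3 h4
    have h5 := ((hQ' _ _ h1).2.2 _ h2).2.2.2.2 (by simp [Formula.code])
    simp only [depOk, Bool.and_eq_true, imp_iff, allAt_iff, beq_iff_eq, allIn_iff] at h5
    refine h5.2.2.1 _ ((hQ' _ _ h1).1 _ h3) ⟨by simp [Formula.code], by simp [Formula.code], h3, ?_⟩
    simp only [Formula.code, Nat.unpair_pair, testBit_setCode]
    rintro _ ⟨z, hz, rfl⟩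
    exact h4 z hz
  · intro i a X y h1 h2 h3
    have h4 := ((hQ' _ _ h1).2.2 _ h2).2.2.2.2 (by simp [Formula.code])
    simp only [depOk, Bool.and_eq_true, imp_iff, allIn_iff, testBit_varMask] at h4
    refine h4.2.1 ?_
    rintro _ ⟨v, rfl⟩
    simpa only [Formula.code, Nat.unpair_pair, testBit_setCode_code] using h3 v
  · intro i a X Z y h1 h2 h3 h4
    have h5 := ((hQ' _ _ h1).2.2 _ h2).2.2.2.2 (by simp [Formula.code])
    simp only [depOk, Bool.and_eq_true, imp_iff, allAt_iff, beq_iff_eq, allIn_iff] at h5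
    refine h5.2.2.2 (by simp [Formula.code, Term.code]) _ (hF.next.1 ((hQ' _ _ h1).1 _ h3))
      ⟨by simp [Formula.code], by simp [Formula.code, Term.code], h3, ?_⟩
    simp only [Formula.code, Nat.unpair_pair, testBit_setCode]
    rintro _ ⟨z, hz, rfl⟩
    exact ⟨_, h4 z hz, rfl⟩

end

/-! ### From a model to a coded quasimodel -/

section Models

variable {V : Type u} {Pred : Type v} {ar : Pred → ℕ} (M : DynModel.{u, v, w} V ar)

theorem DynModel.termVal_iterate (k : ℕ) (x : Term V) (s : M.S) :
    M.termVal (Term.next^[k] x) s = M.termVal x (M.g^[k] s) := by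
  induction k generalizing s with
  | zero => rfl
  | succ k ih => rw [Function.iterate_succ_apply', Function.iterate_succ_apply, ← ih]; rfl

theorem DynModel.sat_iterate (k : ℕ) (φ : Formula V ar) (s : M.S) :
    M.Sat (Formula.next^[k] φ) s ↔ M.Sat φ (M.g^[k] s) := by
  induction k generalizing s with
  | zero => exact Iff.rfl
  | succ k ih => rw [Function.iterate_succ_apply', Function.iterate_succ_apply, ← ih]; rfl

/-- Agreement on `Z` makes the `=_Z` classes of `s` and `t` coincide. For `D_Z y` the reference
value could differ between `s` and `t`, but each lies in the class of the other. -/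
theorem DynModel.sat_detNow {L : Term V → Prop} {φ : Formula V ar} (hφ : φ.DetNow L) {s t : M.S}
    (hst : ∀ y, L y → M.termVal y s = M.termVal y t) : M.Sat φ s ↔ M.Sat φ t := by
  have key : ∀ Z : Finset (Term V), (∀ z ∈ Z, L z) → ∀ r, M.Agree Z s r ↔ M.Agree Z t r :=
    fun Z hZ r => forall₂_congr fun z hz => by rw [hst z (hZ z hz)]
  cases φ with
  | atom P x =>
    have : (fun i => M.termVal (x i) s) = fun i => M.termVal (x i) t :=
      funext fun i => hst _ (hφ i)
    rw [DynModel.Sat, DynModel.Sat, this]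
  | quant Z φ => exact forall_congr' fun r => by rw [key Z hφ]
  | dep Z y =>
    have h : M.Agree Z s t := fun z hz => hst z (hφ z hz)
    constructor
    · intro h1 r hr
      rw [← h1 t h]
      exact h1 r ((key Z hφ r).2 hr)
    · intro h1 r hr
      rw [← h1 s ((key Z hφ s).1 fun _ _ => rfl)]
      exact h1 r ((key Z hφ r).1 hr)
  | _ => exact hφ.elim

theorem DynModel.sat_det {L : Term V → Prop} {φ : Formula V ar} (hφ : φ.Det L) {s t : M.S}
    (hst : ∀ y, L y → M.termVal y s = M.termVal y t) : M.Sat φ s ↔ M.Sat φ t := by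
  obtain ⟨k, χ, rfl, hχ⟩ := hφ
  rw [DynModel.sat_iterate, DynModel.sat_iterate]
  refine M.sat_detNow hχ fun y hy => ?_
  rw [← DynModel.termVal_iterate, ← DynModel.termVal_iterate]
  exact hst _ hy

variable [Encodable V] [Finite V] [Encodable Pred] {c tb N T F : ℕ}

/-- Every state contributes its type at every time `i ≤ N`, not only the states reached by `i` steps
of `g`. Witnesses for quantifiers are thus available at the same time, and the successor of a type
is the type of the image under `g`. -/
theorem isQuasi_of_model {typ : ℕ → M.S → ℕ}
    (htyp : ∀ i s x, (typ i s).testBit x = true ↔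
      has i x F = true ∧ ∃ φ : Formula V ar, φ.code = x ∧ M.Sat φ s)
    (hdec : ∀ i x, has i x F = true → ∃ φ : Formula V ar, φ.code = x)
    (hF : Closure (fun i (φ : Formula V ar) => has i φ.code F = true) N) {Q : ℕ}
    (hQ : ∀ i τ, has i τ Q = true ↔ i ≤ N ∧ ∃ s, τ = typ i s) :
    isQuasi (varMask V) N F Q = true := by
  have htyp' : ∀ i s (φ : Formula V ar), (typ i s).testBit φ.code = true ↔
      has i φ.code F = true ∧ M.Sat φ s := by
    intro i s φ
    rw [htyp]
    refine and_congr_right fun _ => ⟨?_, fun h => ⟨φ, rfl, h⟩⟩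
    rintro ⟨ψ, h1, h2⟩
    exact Formula.code_injective h1 ▸ h2
  rw [isQuasi, allIn_iff]
  intro q hq
  obtain ⟨i, τ, rfl⟩ : ∃ i τ, q = Nat.pair i τ := ⟨_, _, (Nat.pair_unpair q).symm⟩
  obtain ⟨hi, s, rfl⟩ := (hQ i τ).1 hq
  simp only [Nat.unpair_pair, typeOk, Bool.and_eq_true, allAt_iff, exAt_iff, imp_iff,
    biff_iff, boole_ble, subAt_iff]
  refine ⟨fun x hx => ((htyp _ _ _).1 hx).1, fun hi' => ?_, fun x hx => ?_⟩
  · refine ⟨typ (i + 1) (M.g s), (hQ _ _).2 ⟨hi', _, rfl⟩, fun x hx => ?_⟩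
    obtain ⟨φ, rfl⟩ := hdec _ _ hx
    rw [← Formula.code_next, htyp', htyp', hF.next]
    rfl
  obtain ⟨φ, rfl⟩ := hdec _ _ hx
  simp only [formulaOk, Bool.and_eq_true, imp_iff, biff_iff, beq_iff_eq]
  cases φ with
  | atom P x =>
    refine ⟨fun _ => ?_, by simp [Formula.code], by simp [Formula.code], by simp [Formula.code],
      by simp [Formula.code]⟩
    simp only [atomOk, Bool.and_eq_true, imp_iff, biff_iff, beq_iff_eq, allLt_iff, allIn_iff,
      Bool.not_eq_true', beq_eq_false_iff_ne]
    constructor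
    · rintro ⟨h1, h2⟩
      simp only [Formula.code, Nat.unpair_pair, argLen_code] at h1 h2
      have h3 : ∀ j, ∃ y, x j = .next y := by
        intro j
        have h4 := h2 j j.2
        rw [argAt_code] at h4
        cases hxj : x j with
        | var v => simp [hxj, Term.code] at h4
        | next y => exact ⟨y, rfl⟩
      choose y hy using h3
      obtain rfl : x = fun j => .next (y j) := funext hy
      have h5 : unshift (Nat.unpair (Formula.atom P fun j => .next (y j) : Formula V ar).code).2 =
          (Formula.atom P y : Formula V ar).code := by
        rw [← unshift_code P y]; simp [Formula.code]
      rw [h5, ← Formula.code_next, htyp', htyp', hF.next]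
      have h6 := hF.atom_shift hx (Nat.pos_of_ne_zero h1)
      simp only [hx, h6, true_and]
      rfl
    · intro h1 q hq h2
      obtain ⟨i', τ, rfl⟩ : ∃ i τ, q = Nat.pair i τ := ⟨_, _, (Nat.pair_unpair q).symm⟩
      obtain ⟨-, t, rfl⟩ := (hQ i' τ).1 hq
      simp only [Nat.unpair_pair] at h2 ⊢
      rw [htyp', htyp']
      simp only [hx, h2, true_and, DynModel.Sat]
      simp only [Formula.code, Nat.unpair_pair, argLen_code] at h1
      rw [show (fun i => M.termVal (x i) s) = fun i => M.termVal (x i) t from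
        funext fun j => absurd j.2 (by omega)]
  | neg φ =>
    refine ⟨by simp [Formula.code], fun _ => ?_, by simp [Formula.code], by simp [Formula.code],
      by simp [Formula.code]⟩
    have h1 : (Formula.neg φ).code.unpair.2 = φ.code := by simp [Formula.code]
    rw [htyp', Bool.not_eq_true', ← Bool.not_eq_true, h1, htyp']
    simp [hx, hF.neg hx, DynModel.Sat]
  | and φ ψ =>
    refine ⟨by simp [Formula.code], by simp [Formula.code], fun _ => ?_, by simp [Formula.code],
      by simp [Formula.code]⟩
    have h1 : (Formula.and φ ψ).code.unpair.2 = Nat.pair φ.code ψ.code := by simp [Formula.code]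
    rw [htyp', h1, Nat.unpair_pair, htyp', htyp']
    simp [hx, hF.and hx, DynModel.Sat]
  | next φ =>
    exact ⟨by simp [Formula.code], by simp [Formula.code], by simp [Formula.code],
      by simp [Formula.code], by simp [Formula.code]⟩
  | quant X φ =>
    refine ⟨by simp [Formula.code], by simp [Formula.code], by simp [Formula.code], fun _ => ?_,
      by simp [Formula.code]⟩
    have hφ := (hF.quant hx).2.2
    simp only [quantOk, Bool.and_eq_true, imp_iff, biff_iff, exAt_iff, allAt_iff, htyp',
      Bool.not_eq_true', ← Bool.not_eq_true]
    simp only [Formula.code, Nat.unpair_pair, htyp']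
    refine ⟨fun h1 => ⟨hφ, h1.2 s fun _ _ => rfl⟩, fun h1 => ?_⟩
    have h2 : ¬ ∀ t, M.Agree X s t → M.Sat φ t := fun h2 => h1 ⟨hx, h2⟩
    push Not at h2
    obtain ⟨t, hst, ht⟩ := h2
    refine ⟨typ i t, (hQ _ _).2 ⟨hi, t, rfl⟩, fun h3 => ht ((htyp' _ _ _).1 h3).2,
      fun z hz hd => ?_⟩
    obtain ⟨χ, rfl⟩ := hdec _ _ hz
    rw [htyp', htyp']
    -- The terms in question satisfy `D_X y` at `s`, so `s =_X t` makes their values equal.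
    refine and_congr_right fun _ => M.sat_det (det_of_isDet hd) fun y hy => ?_
    exact ((htyp' _ _ _).1 hy).2 t hst
  | dep X y =>
    refine ⟨by simp [Formula.code], by simp [Formula.code], by simp [Formula.code],
      by simp [Formula.code], fun _ => ?_⟩
    simp only [depOk, Bool.and_eq_true, imp_iff, allAt_iff, beq_iff_eq, allIn_iff, htyp', hx,
      true_and, testBit_varMask]
    refine ⟨fun h1 t hst => ?_, fun h1 t hst => ?_, fun z hz h1 t hst => ?_,
      fun h1 z hz h2 t hst => ?_⟩
    · simp only [Formula.code, Nat.unpair_pair, testBit_setCode_code] at h1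
      exact hst y h1
    · have : s = t := M.state_ext s t fun v => Subtype.ext (hst (.var v) (by
        have := h1 _ ⟨v, rfl⟩
        simpa only [Formula.code, Nat.unpair_pair, testBit_setCode_code] using this))
      rw [this]
    · obtain ⟨χ, rfl⟩ := hdec _ _ hz
      obtain ⟨h1, h2, h3, h4⟩ := h1
      cases χ <;> simp only [Formula.code, Nat.unpair_pair] at h1 <;> try omega
      rename_i Z y'
      simp only [Formula.code, Nat.unpair_pair] at h2
      obtain rfl := Term.code_injective h2
      refine ((htyp' _ _ _).1 h3).2 t fun z hz => ?_
      have h5 := h4 z.code (by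
        simpa only [Formula.code, Nat.unpair_pair, testBit_setCode_code] using hz)
      simp only [Formula.code, Nat.unpair_pair] at h5
      exact ((htyp' _ _ (.dep X z)).1 h5).2 t hst
    · obtain ⟨χ, rfl⟩ := hdec _ _ hz
      obtain ⟨h3, h4, h5, h6⟩ := h2
      cases χ <;> simp only [Formula.code, Nat.unpair_pair] at h3 <;> try omega
      rename_i Z y'
      cases y with
      | var v => simp [Formula.code, Term.code] at h1
      | next y =>
        simp only [Formula.code, Nat.unpair_pair, Term.code] at h4
        obtain rfl := Term.code_injective h4
        refine ((htyp' _ _ (.next (.dep Z y'))).1 h5).2 (M.g t) fun z hz => ?_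
        have h7 := h6 z.code (by
          simpa only [Formula.code, Nat.unpair_pair, testBit_setCode_code] using hz)
        simp only [Formula.code, Nat.unpair_pair] at h7
        rw [← Term.code_next, testBit_setCode_code] at h7
        exact hst _ h7

theorem refutable_of_not_valid (htb : IsTable ar c tb) {φ : Formula V ar}
    (h : isClosed tb (varMask V) φ.code N T F = true) (hc : φ.code = c) {s : M.S}
    (hs : ¬ M.Sat φ s) : refutable (varMask V) φ.code N F = true := by
  subst hc
  have hF := closure_of_isClosed htb h
  have hdec := fun i x (hx : has i x F = true) => exists_formula_of_isClosed htb h hx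
  choose typ htyp₁ htyp₂ using fun i (s : M.S) => exists_testBit_iff F fun x =>
    has i x F = true ∧ ∃ ψ : Formula V ar, ψ.code = x ∧ M.Sat ψ s
  have htyp : ∀ i s x, (typ i s).testBit x = true ↔
      has i x F = true ∧ ∃ φ : Formula V ar, φ.code = x ∧ M.Sat φ s := by
    intro i s x
    rw [htyp₂]
    exact ⟨fun h => h.2, fun h => ⟨(Nat.right_le_pair i x).trans_lt (lt_of_has h.1), h⟩⟩
  obtain ⟨Q, hQ₁, hQ₂⟩ := exists_testBit_iff (Nat.pair (N + 1) (2 ^ F)) fun q =>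
    q.unpair.1 ≤ N ∧ ∃ s, q.unpair.2 = typ q.unpair.1 s
  have hQ : ∀ i τ, has i τ Q = true ↔ i ≤ N ∧ ∃ s, τ = typ i s := by
    intro i τ
    rw [has, hQ₂]
    simp only [Nat.unpair_pair]
    refine ⟨fun h => h.2, fun h => ⟨?_, h⟩⟩
    obtain ⟨h1, t, rfl⟩ := h
    -- This is the bound on quasimodels in `refutable`: times are at most `N`, and types are sets of
    -- numbers below `F`.
    exact (Nat.pair_lt_pair_left _ (by omega)).trans (Nat.pair_lt_pair_right _ (htyp₁ i t))
  simp only [refutable, exLt_iff, Bool.and_eq_true, exAt_iff, Bool.not_eq_true',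
    ← Bool.not_eq_true]
  refine ⟨Q, hQ₁, isQuasi_of_model M htyp (fun i x hx => (hdec i x hx).imp fun _ h => h.2) hF hQ,
    typ 0 s, (hQ _ _).2 ⟨by omega, s, rfl⟩, fun h1 => ?_⟩
  obtain ⟨-, ψ, h2, h3⟩ := (htyp _ _ _).1 h1
  exact hs (Formula.code_injective h2 ▸ h3)

theorem refutable_iff_not_valid (htb : IsTable ar c tb) {φ : Formula V ar}
    (h : isClosed tb (varMask V) c N T F = true) (hc : φ.code = c) :
    refutable (varMask V) c N F = true ↔ ¬ Formula.Valid.{u, v, w} φ := by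
  subst hc
  constructor
  · intro h1
    have hF := closure_of_isClosed htb h
    simp only [refutable, exLt_iff, Bool.and_eq_true, exAt_iff, Bool.not_eq_true',
      ← Bool.not_eq_true] at h1
    obtain ⟨Q, -, hQ, τ, hτ, hτφ⟩ := h1
    refine (quasiModel_of_isQuasi hF hQ).exists_model hF hτ ?_ hτφ
    rw [isClosed, Bool.and_eq_true] at h
    exact h.1
  · intro h1
    simp only [Formula.Valid, not_forall] at h1
    obtain ⟨M, s, hs⟩ := h1
    exact refutable_of_not_valid M htb h rfl hs

end Models

/-! ### Existence of a finite closed family -/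

theorem exists_testBit_of_finite {s : Set ℕ} (hs : s.Finite) :
    ∃ S : ℕ, ∀ y, S.testBit y = true ↔ y ∈ s := by
  obtain ⟨n, hn⟩ := hs.bddAbove
  obtain ⟨S, -, hS⟩ := exists_testBit_iff (n + 1) fun y => y ∈ s
  exact ⟨S, fun y => (hS y).trans ⟨fun h => h.2, fun h => ⟨Nat.lt_succ_of_le (hn h), h⟩⟩⟩

section

variable {V : Type u} {Pred : Type v} {ar : Pred → ℕ}

/-- At time `i`, the formula only mentions values at times up to `N`. -/
def Formula.Fits (N : ℕ) : ℕ → Formula V ar → Prop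
  | i, .atom _ x => i ≤ N ∧ ∀ j, i + (x j).depth ≤ N
  | i, .neg φ => φ.Fits N i
  | i, .and φ ψ => φ.Fits N i ∧ ψ.Fits N i
  | i, .next φ => φ.Fits N (i + 1)
  | i, .quant X φ => (∀ x ∈ X, i + x.depth ≤ N) ∧ φ.Fits N i
  | i, .dep X y => (∀ x ∈ X, i + x.depth ≤ N) ∧ i + y.depth ≤ N

theorem Formula.Fits.le {N i : ℕ} {φ : Formula V ar} (h : φ.Fits N i) : i ≤ N := by
  induction φ generalizing i with
  | atom P x => exact h.1
  | neg φ ih => exact ih h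
  | and φ ψ ih _ => exact ih h.1
  | next φ ih => exact (Nat.le_succ i).trans (ih h)
  | quant X φ ih => exact ih h.2
  | dep X y => exact (Nat.le_add_right _ _).trans h.2

theorem Formula.exists_fits (φ : Formula V ar) (i : ℕ) : ∃ N, ∀ N' ≥ N, φ.Fits N' i := by
  have key : ∀ X : Finset (Term V), ∀ N' ≥ i + X.sup Term.depth, ∀ x ∈ X, i + x.depth ≤ N' :=
    fun X N' h x hx => (Nat.add_le_add_left (Finset.le_sup (f := Term.depth) hx) i).trans h
  induction φ generalizing i with
  | atom P x =>
    refine ⟨i + Finset.univ.sup fun j => (x j).depth, fun N' h => ⟨by omega, fun j => ?_⟩⟩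
    have := Finset.le_sup (f := fun j => (x j).depth) (Finset.mem_univ j)
    omega
  | neg φ ih => exact ih i key
  | and φ ψ ih₁ ih₂ =>
    obtain ⟨N₁, h₁⟩ := ih₁ i key
    obtain ⟨N₂, h₂⟩ := ih₂ i key
    exact ⟨max N₁ N₂, fun N' h => ⟨h₁ N' (le_of_max_le_left h), h₂ N' (le_of_max_le_right h)⟩⟩
  | next φ ih =>
    exact ih (i + 1) fun X N' h x hx =>
      (Nat.add_le_add_left (Finset.le_sup (f := Term.depth) hx) _).trans h
  | quant X φ ih =>
    obtain ⟨N, hN⟩ := ih i key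
    exact ⟨max N (i + X.sup Term.depth), fun N' h =>
      ⟨key X N' (le_of_max_le_right h), hN N' (le_of_max_le_left h)⟩⟩
  | dep X y =>
    exact ⟨max (i + y.depth) (i + X.sup Term.depth), fun N' h =>
      ⟨key X N' (le_of_max_le_right h), le_of_max_le_left h⟩⟩

theorem finite_depth_le [Finite V] (N : ℕ) : {t : Term V | t.depth ≤ N}.Finite := by
  have h : Set.InjOn (fun t : Term V => (t.depth, t.base)) {t | t.depth ≤ N} := by
    intro s _ t _ hst
    simp only [Prod.mk.injEq] at hst
    exact Term.ext_depth_base hst.1 hst.2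
  refine Set.Finite.of_finite_image (((Set.finite_Iic N).prod Set.finite_univ).subset ?_) h
  rintro _ ⟨t, ht, rfl⟩
  exact ⟨ht, trivial⟩

variable [Encodable V] [Finite V] [Encodable Pred]

variable (ar) in
-- As `V` is finite there are only finitely many terms of depth at most `N`, and so finitely many
-- atoms with the given symbols and finitely many dependence atoms over them.
theorem exists_code_le (c N : ℕ) : ∃ H,
    (∀ P (x : Fin (ar P) → Term V), Encodable.encode P ≤ c → (∀ j, (x j).depth ≤ N) →
      (Formula.atom P x : Formula V ar).code ≤ H) ∧
    ∀ (X : Finset (Term V)) y, (∀ x ∈ X, x.depth ≤ N) → y.depth ≤ N →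
      (Formula.dep X y : Formula V ar).code ≤ H := by
  have hP : {P : Pred | Encodable.encode P ≤ c}.Finite :=
    Set.Finite.preimage Encodable.encode_injective.injOn (Set.finite_Iic c)
  have h1 : (⋃ P ∈ {P : Pred | Encodable.encode P ≤ c}, Formula.atom P ''
      Set.pi Set.univ fun _ : Fin (ar P) => {t : Term V | t.depth ≤ N}).Finite :=
    hP.biUnion fun P _ => (Set.Finite.pi fun _ => finite_depth_le N).image _
  have h2 : (Set.image2 (Formula.dep (ar := ar))
      {X : Finset (Term V) | (X : Set (Term V)) ⊆ {t | t.depth ≤ N}} {t | t.depth ≤ N}).Finite :=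
    Set.Finite.image2 _ ((finite_depth_le N).toFinset.powerset.finite_toSet.subset fun X hX => by
      rw [Finset.mem_coe, Finset.mem_powerset]
      exact fun t ht => (Set.Finite.mem_toFinset _).2 (hX ht)) (finite_depth_le N)
  obtain ⟨H₁, hH₁⟩ := (h1.image Formula.code).bddAbove
  obtain ⟨H₂, hH₂⟩ := (h2.image Formula.code).bddAbove
  refine ⟨max H₁ H₂, fun P x hc hx => ?_, fun X y hX hy => ?_⟩
  · refine le_max_of_le_left (hH₁ ⟨_, ?_, rfl⟩)
    simp only [Set.mem_iUnion]
    exact ⟨P, hc, x, fun j _ => hx j, rfl⟩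
  · exact le_max_of_le_right (hH₂ ⟨_, ⟨X, fun x hx => hX x hx, y, hy, rfl⟩, rfl⟩)

theorem exists_isClosed {c tb : ℕ} (htb : IsTable ar c tb) {φ : Formula V ar} (hφ : φ.EmptyFree)
    (hc : φ.code = c) : ∃ N T F, isClosed tb (varMask V) c N T F = true := by
  obtain ⟨N, hN⟩ := φ.exists_fits 0
  replace hN := hN N le_rfl
  obtain ⟨H₀, hH₁, hH₂⟩ := exists_code_le (V := V) ar c N
  -- The bound shrinks with time so that `b i = Nat.pair 3 (b (i + 1))`: then `○ψ` is within the
  -- bound at time `i` exactly when `ψ` is at time `i + 1`. It never falls below `H₀`, so all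
  -- dependence atoms and all shifted atoms fit at every time.
  let b : ℕ → ℕ := fun i => (Nat.pair 3)^[N - i] (max H₀ c)
  have hb₁ : ∀ i, H₀ ≤ b i := fun i => (le_max_left _ _).trans (le_iterate_pair _ _)
  have hb₂ : ∀ i, i + 1 ≤ N → b i = Nat.pair 3 (b (i + 1)) := by
    intro i hi
    simp only [b]
    rw [show N - i = N - (i + 1) + 1 by omega, Function.iterate_succ_apply']
  have hmono : ∀ x y, Nat.pair 3 x ≤ Nat.pair 3 y ↔ x ≤ y := by
    intro x y
    constructor
    · intro h
      by_contra h'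
      have := Nat.pair_lt_pair_right 3 (not_le.1 h')
      omega
    · intro h
      rcases h.eq_or_lt with rfl | h
      · exact le_rfl
      · exact (Nat.pair_lt_pair_right 3 h).le
  -- The bound on predicate codes keeps the family within the part of the arity table known to be
  -- complete.
  let Fam : ℕ → Formula V ar → Prop := fun i ψ =>
    ψ.EmptyFree ∧ ψ.Fits N i ∧ ψ.PredsLe c ∧ ψ.code ≤ b i
  have hTfin : {p : ℕ | p.unpair.1 ≤ N ∧
      ∃ t : Term V, t.code = p.unpair.2 ∧ p.unpair.1 + t.depth ≤ N}.Finite := by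
    refine (((Set.finite_Iic N).prod ((finite_depth_le (V := V) N).image Term.code)).image
      fun p => Nat.pair p.1 p.2).subset ?_
    rintro p ⟨h1, t, h2, h3⟩
    refine ⟨(p.unpair.1, p.unpair.2), ⟨h1, t, ?_, h2⟩, Nat.pair_unpair p⟩
    simp only [Set.mem_ofPred_eq]; omega
  have hFfin : {p : ℕ | ∃ ψ, ψ.code = p.unpair.2 ∧ Fam p.unpair.1 ψ}.Finite := by
    refine ((Set.finite_Iic N).biUnion fun i _ => (Set.finite_Iic (b i)).image (Nat.pair i)).subset
      ?_
    rintro p ⟨ψ, h1, h2⟩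
    simp only [Set.mem_iUnion]
    exact ⟨_, h2.2.1.le, _, h1 ▸ h2.2.2.2, Nat.pair_unpair p⟩
  obtain ⟨T, hT⟩ := exists_testBit_of_finite hTfin
  obtain ⟨F, hF⟩ := exists_testBit_of_finite hFfin
  have hT' : ∀ i (t : Term V), has i t.code T = true ↔ i + t.depth ≤ N := by
    intro i t
    rw [has, hT]
    simp only [Set.mem_ofPred_eq, Nat.unpair_pair]
    constructor
    · rintro ⟨-, t', h1, h2⟩
      rwa [Term.code_injective h1] at h2
    · exact fun h => ⟨by omega, t, rfl, h⟩
  have hF' : ∀ i (ψ : Formula V ar), has i ψ.code F = true ↔ Fam i ψ := by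
    intro i ψ
    rw [has, hF]
    simp only [Set.mem_ofPred_eq, Nat.unpair_pair]
    constructor
    · rintro ⟨χ, h1, h2⟩
      rwa [Formula.code_injective h1] at h2
    · exact fun h => ⟨ψ, rfl, h⟩
  have hT'' : ∀ i z, has i z T = true → ∃ t : Term V, t.code = z := by
    intro i z hz
    obtain ⟨-, t, h1, -⟩ := (hT _).1 hz
    exact ⟨t, by simpa using h1⟩
  refine ⟨N, T, F, ?_⟩
  simp only [isClosed, Bool.and_eq_true, allIn_iff, allAt_iff, allLt_iff, imp_iff,
    Bool.not_eq_true', beq_eq_false_iff_ne]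
  refine ⟨?_, ?_, fun p hp => ?_, fun i _ X _ y hy hX => ?_⟩
  · rw [← hc, hF']
    exact ⟨hφ, hN, φ.predsLe_of_code_le hc.le,
      hc.le.trans ((le_max_right _ _).trans (le_iterate_pair _ _))⟩
  · simp only [termsOk, Bool.and_eq_true, allIn_iff, allLt_iff, imp_iff, Bool.or_eq_true,
      beq_iff_eq, boole_ble, subAt_iff, testBit_varMask]
    refine ⟨fun p hp => ?_, ?_⟩
    · obtain ⟨h1, t, h2, h3⟩ := (hT p).1 hp
      rw [← h2]
      refine ⟨h1, ?_, fun h4 => ?_⟩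
      · cases t with
        | var v => exact Or.inl ⟨v, rfl⟩
        | next t =>
          refine Or.inr ⟨by simp [Term.code], ?_⟩
          simp only [Term.code, Nat.unpair_pair]
          rw [hT']
          simp only [Term.depth] at h3; omega
      · rw [← Term.code_next, hT']
        simp only [Term.depth]; omega
    · rintro i hi _ ⟨v, rfl⟩
      rw [hT']
      simp only [Term.depth]; omega
  · obtain ⟨ψ, h1, h2⟩ := (hF p).1 hp
    rw [← h1]
    generalize p.unpair.1 = i at h2
    clear h1 hp
    simp only [closedAt, Bool.and_eq_true, allLt_iff, imp_iff, beq_iff_eq, boole_ble,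
      Bool.not_eq_true', beq_eq_false_iff_ne]
    obtain ⟨hef, hfit, hpr, hcode⟩ := h2
    have hi := hfit.le
    refine ⟨hi, isFm_code htb ψ hpr hef, ?_, ?_, ?_, ?_, ?_, ?_, fun h1 => ?_⟩
    · intro h1
      cases ψ <;> simp only [Formula.code, Nat.unpair_pair] at h1 <;> try omega
      rename_i P x
      simp only [Formula.code, Nat.unpair_pair, argLen_code]
      refine ⟨fun j hj => ?_, fun h2 => ?_⟩
      · have := argAt_code P x ⟨j, hj⟩
        simp only at this
        rw [this, hT']
        exact hfit.2 _
      · obtain ⟨h2, h3⟩ := h2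
        have h4 : ∀ j, ∃ y, x j = .next y := by
          intro j
          have h4 := h3 j j.2
          rw [argAt_code] at h4
          cases hxj : x j with
          | var v => simp [hxj, Term.code] at h4
          | next y => exact ⟨y, rfl⟩
        choose y hy using h4
        obtain rfl : x = fun j => .next (y j) := funext hy
        rw [unshift_code, hF']
        have h5 : ∀ j, i + 1 + (y j).depth ≤ N := by
          intro j
          have := hfit.2 j
          simp only [Term.depth] at this
          omega
        refine ⟨trivial, ⟨?_, h5⟩, hpr, (hH₁ P y hpr fun j => ?_).trans (hb₁ _)⟩
        · have := h5 ⟨0, Nat.pos_of_ne_zero h2⟩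
          omega
        · have := h5 j
          omega
    · intro h1
      cases ψ <;> simp only [Formula.code, Nat.unpair_pair] at h1 <;> try omega
      simp only [Formula.code, Nat.unpair_pair, hF']
      exact ⟨hef, hfit, hpr, (Nat.right_le_pair _ _).trans hcode⟩
    · intro h1
      cases ψ <;> simp only [Formula.code, Nat.unpair_pair] at h1 <;> try omega
      simp only [Formula.code, Nat.unpair_pair, hF']
      exact ⟨⟨hef.1, hfit.1, hpr.1,
          (Nat.left_le_pair _ _).trans ((Nat.right_le_pair _ _).trans hcode)⟩,
        hef.2, hfit.2, hpr.2, (Nat.right_le_pair _ _).trans ((Nat.right_le_pair _ _).trans hcode)⟩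
    · intro h1
      cases ψ <;> simp only [Formula.code, Nat.unpair_pair] at h1 <;> try omega
      simp only [Formula.code, Nat.unpair_pair, hF']
      refine ⟨hef, hfit, hpr, ?_⟩
      rwa [hb₂ i (Formula.Fits.le (i := i + 1) hfit), Formula.code_next, hmono] at hcode
    · intro h1
      cases ψ <;> simp only [Formula.code, Nat.unpair_pair] at h1 <;> try omega
      simp only [Formula.code, Nat.unpair_pair, hF', subAt_setCode, hT']
      exact ⟨hfit.1, hef.2, hfit.2, hpr,
        (Nat.right_le_pair _ _).trans ((Nat.right_le_pair _ _).trans hcode)⟩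
    · intro h1
      cases ψ <;> simp only [Formula.code, Nat.unpair_pair] at h1 <;> try omega
      simp only [Formula.code, Nat.unpair_pair, subAt_setCode, hT']
      exact hfit
    · rw [← Formula.code_next, hF']
      obtain ⟨i, rfl⟩ : ∃ i', i = i' + 1 := ⟨i - 1, by omega⟩
      refine ⟨hef, hfit, hpr, ?_⟩
      rwa [Nat.add_sub_cancel, hb₂ i hi, Formula.code_next, hmono]
  · obtain ⟨hX0, hX⟩ := hX
    obtain ⟨Y, rfl⟩ := exists_setCode (V := V) fun z hz => hT'' i z (subAt_iff.1 hX z hz)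
    obtain ⟨t, rfl⟩ := hT'' i y hy
    rw [← Formula.code_dep (ar := ar), hF']
    rw [subAt_setCode] at hX
    simp only [hT'] at hX hy
    refine ⟨setCode_ne_zero.1 hX0, ⟨hX, hy⟩, trivial, (hH₂ Y t (fun x hx => ?_) ?_).trans (hb₁ _)⟩
    · have := hX x hx
      omega
    · omega

end

/-! ### Arity tables and the decision procedure -/

section Table

variable {Pred : Type v} [Primcodable Pred] (ar : Pred → ℕ)

/-- The `n`-th entry of the table of arities. -/
def arityEntry (n : ℕ) : ℕ := (Encodable.decode₂ Pred n).elim 0 fun P => ar P + 1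

/-- The table of the arities of predicate symbols with codes `< n`. -/
def arityTable (n : ℕ) : List ℕ := (List.range n).map (arityEntry ar)

variable {ar}

theorem computable_arityTable (har : Computable ar) : Computable (arityTable ar) := by
  have h1 : Computable (arityEntry ar) := by
    have h : Computable₂ fun (_ : ℕ) (P : Pred) => ar P + 1 :=
      (Computable.succ.comp (har.comp Computable.snd)).to₂
    refine (Computable.option_casesOn Primrec.decode₂.to_comp (Computable.const 0) h).of_eq
      fun n => ?_
    unfold arityEntry
    cases Encodable.decode₂ Pred n <;> rfl
  have h2 : Computable₂ fun (_ : ℕ) (p : ℕ × List ℕ) => p.2 ++ [arityEntry ar p.1] :=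
    (Computable.list_concat.comp (Computable.snd.comp Computable.snd)
      (h1.comp (Computable.fst.comp Computable.snd))).to₂
  refine (Computable.nat_rec Computable.id (Computable.const []) h2).of_eq fun n => ?_
  simp only [id]
  induction n with
  | zero => rfl
  | succ n ih => rw [arityTable, List.range_succ, List.map_append, ← arityTable, ← ih]; rfl

/-- Entry 0 means that there is no such symbol. Decoding with `decode₂` rejects numbers that decode
to a symbol without being its code. -/
theorem isTable_arityTable (c : ℕ) : IsTable ar c (Encodable.encode (arityTable ar (c + 1))) := by
  have key : ∀ n, entry (Encodable.encode (arityTable ar (c + 1))) n =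
      if n < c + 1 then arityEntry ar n else 0 := by
    intro n
    unfold entry arityTable
    rw [Denumerable.ofNat_encode]
    split_ifs with h
    · rw [List.getD_eq_getElem _ _ (by simpa using h)]
      simp
    · rw [List.getD_eq_default _ _ (by simpa using h)]
  constructor
  · intro n k h
    rw [key] at h
    split_ifs at h
    unfold arityEntry at h
    cases hd : Encodable.decode₂ Pred n with
    | none => simp [hd] at h
    | some P => exact ⟨P, Encodable.decode₂_eq_some.1 hd, by simpa [hd] using h⟩
  · intro P hP
    rw [key, if_pos (by omega), arityEntry, Encodable.decode₂_encode]
    rfl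

end Table

theorem exists_computable_search {A : ℕ → ℕ → Bool} (hA : Computable₂ A)
    (h : ∀ a, ∃ n, A a n = true) : ∃ f : ℕ → ℕ, Computable f ∧ ∀ a, A a (f a) = true := by
  refine ⟨fun a => Nat.find (h a), ?_, fun a => Nat.find_spec (h a)⟩
  refine (Partrec.rfind hA.partrec₂).of_eq_tot fun a => ?_
  rw [Nat.mem_rfind]
  refine ⟨by simpa using (Nat.find_spec (h a)).symm, fun {m} hm => ?_⟩
  have := Nat.find_min (h a) hm
  simpa using this

/-- The test for a closed family of sets of formulas, coded by `n`, containing the formula `c`. -/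
def closedTest (vm c tb n : ℕ) : Bool :=
  imp (isFm tb vm c) (isClosed tb vm c n.unpair.1 n.unpair.2.unpair.1 n.unpair.2.unpair.2)

/-- The test for validity of the formula `c`, given a closed family of sets of formulas. -/
def validTest (vm c tb n : ℕ) : Bool :=
  isFm tb vm c && !refutable vm c n.unpair.1 n.unpair.2.unpair.2

theorem computable_closedTest (vm : ℕ) {α : Type*} [Primcodable α] {f g h : α → ℕ}
    (hf : Computable f) (hg : Computable g) (hh : Computable h) :
    Computable fun a => closedTest vm (f a) (g a) (h a) := by
  have h0 : PrimFun fun p : (ℕ × ℕ) × ℕ => closedTest vm p.1.1 p.1.2 p.2 := by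
    unfold closedTest; fun_prop
  have h1 := Computable.comp (Primrec.to_comp h0) ((hf.pair hg).pair hh)
  exact h1

theorem computable_validTest (vm : ℕ) {α : Type*} [Primcodable α] {f g h : α → ℕ}
    (hf : Computable f) (hg : Computable g) (hh : Computable h) :
    Computable fun a => validTest vm (f a) (g a) (h a) := by
  have h0 : PrimFun fun p : (ℕ × ℕ) × ℕ => validTest vm p.1.1 p.1.2 p.2 := by
    unfold validTest; fun_prop
  have h1 := Computable.comp (Primrec.to_comp h0) ((hf.pair hg).pair hh)
  exact h1

end DFD

open DFD in
theorem mainTheorem5 {V : Type u} [Finite V] [Encodable V] {Pred : Type v} [Primcodable Pred]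
    (ar : Pred → ℕ) (har : Computable ar) :
    ComputablePred fun c : ℕ =>
      ∃ φ : DFD.Formula V ar, φ.EmptyFree ∧ DFD.Formula.Valid.{u, v, w} φ ∧ φ.code = c := by
  obtain ⟨tb, hcomp, htb⟩ : ∃ tb : ℕ → ℕ, Computable tb ∧ ∀ c, IsTable ar c (tb c) :=
    ⟨fun c => Encodable.encode (arityTable ar (c + 1)),
      Computable.encode.comp ((computable_arityTable har).comp Computable.succ),
      isTable_arityTable⟩
  -- The search for a closed family is unbounded; it is total because the test is vacuous on numbers
  -- that are not codes of formulas.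
  obtain ⟨f, hf, hfA⟩ := exists_computable_search
    (computable_closedTest (varMask V) Computable.fst (hcomp.comp Computable.fst)
      Computable.snd).to₂ fun c => by
    by_cases h : isFm (tb c) (varMask V) c = true
    · obtain ⟨φ, hφ, hc⟩ := exists_of_isFm (htb c) h
      obtain ⟨N, T, F, hcl⟩ := exists_isClosed (htb c) hφ hc
      exact ⟨Nat.pair N (Nat.pair T F), imp_iff.2 fun _ => by simpa only [Nat.unpair_pair] using hcl⟩
    · exact ⟨0, imp_iff.2 fun h' => absurd h' h⟩
  rw [ComputablePred.computable_iff]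
  refine ⟨_, computable_validTest (varMask V) Computable.id hcomp hf, ?_⟩
  funext c
  rw [eq_iff_iff, validTest, Bool.and_eq_true, Bool.not_eq_true', ← Bool.not_eq_true]
  have hcl := imp_iff.1 (hfA c)
  constructor
  · rintro ⟨φ, hφ, hv, hc⟩
    have h := isFm_code (htb c) φ (φ.predsLe_of_code_le hc.le) hφ
    rw [hc] at h
    exact ⟨h, fun h' => (refutable_iff_not_valid.{u, v, w} (htb c) (hcl h) hc).1 h' hv⟩
  · rintro ⟨h, h'⟩
    obtain ⟨φ, hφ, hc⟩ := exists_of_isFm (htb c) h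
    exact ⟨φ, hφ, by_contra fun hv =>
      h' ((refutable_iff_not_valid.{u, v, w} (htb c) (hcl h) hc).2 hv), hc⟩
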